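/- Let $G$ be a critical binary Galton–Watson tree, i.e. a Galton–Watson tree with offspring distribution $\tfrac12(\delta_0+\delta_2)$, with root $\emptyset$; add a vertex $\star$ and an edge joining $\star$ to $\emptyset$. Write $L(T)$ for the set of leaves of a tree $T$ ($\star$ is not a leaf; $\emptyset$ is a leaf if it has no children) and $N(T)$ for the set of its internal nodes (the vertices other than $\star$ and the leaves). Fix an integer $n\ge 1$ and let $G_n=\mathcal P_n(G)$ be the pruned tree obtained, conditionally on $G$, as follows. (1) Give the edges of $G$ (including $(\star,\emptyset)$) i.i.d. $\mathrm{Exp}(2)$ lengths. (2) Given $G$ and the lengths, let every internal node $x\in N(G)$ send marks forming a Poisson point process of rate $1/n$ on the branch joining $x$ to $\star$, independently for different $x$; all marks are initially active. (3) Explore the tree from the top down to $\star$ (by decreasing distance to $\star$); each time an active mark is met, remove the whole subtree above it, replace it by a leaf, and deactivate all marks sent by the nodes of the removed subtree. The resulting tree is $G_n$. There is exactly one sequence $(c^n_k)_{k\ge1}$ of nonnegative reals such that $$\sum_{k\ge1}k\,c^n_k=1,\qquad \Big(2+\frac{k-1}{n}\Big)c^n_k=\frac{1}{\sum_{l\ge1}c^n_l}\sum_{i=1}^{k-1}c^n_i\,c^n_{k-i}\quad(k\ge2);$$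 put $p^n_k=c^n_k/\sum_{l\ge1}c^n_l$ (the law of the mass of a typical particle). Almost surely $G$ is finite and each internal node sends finitely many marks (so that the exploration in (3) has finitely many steps), and: (i) for all $k\ge1$, $\displaystyle \Pr[|L(G)|=k]=p_k:=\frac{2}{4^k k}\binom{2k-2}{k-1}$; (ii) for all $k\ge1$, $\Pr[|L(G_n)|=k]=p^n_k$; that is, $|L(G_n)|$ is an exact sample of the mass of a typical particle. -/

import Mathlib

open MeasureTheory ProbabilityTheory
open scoped ENNReal NNReal

namespace ForestFire

noncomputable section

/-! ### Equilibrium of the coagulation-fragmentation equation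

Sequences `(u_k)_{k ≥ 1}` are functions `ℕ → ℝ`; the unused entry `u 0` is required to be `0`. -/

/-- The moment `m_i(u) = ∑_{k ≥ 1} k ^ i u_k` (for sequences with `u 0 = 0`). -/
def moment (i : ℕ) (u : ℕ → ℝ) : ℝ := ∑' k : ℕ, (k : ℝ) ^ i * u k

/-- `c` is an equilibrium state with total mass `1`. -/
structure IsEquilibrium (n : ℕ) (c : ℕ → ℝ) : Prop where
  zero : c 0 = 0
  nonneg : ∀ k, 0 ≤ c k
  mass : HasSum (fun k : ℕ => (k : ℝ) * c k) 1
  balance : ∀ k : ℕ, 2 ≤ k →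
    (2 + ((k : ℝ) - 1) / n) * c k
      = 1 / moment 0 c * ∑ i ∈ Finset.Ico 1 k, c i * c (k - i)

/-- The law `p_k = 2 / (4 ^ k k) * binom (2k - 2) (k - 1)`, for `k ≥ 1`. -/
def criticalLaw (k : ℕ) : ℝ :=
  2 / ((4 : ℝ) ^ k * k) * ((2 * k - 2).choose (k - 1) : ℝ)

/-! ### Trees

A vertex is a word in `List ℕ`; the root `∅` is `[]` and the `i`-th child of `u` is `u ++ [i]`.
A tree is a set of words. The extra vertex `⋆` below the root is not a word; every vertex `u` of
a tree is the upper end of exactly one edge, which joins it to its parent (to `⋆` if `u = []`),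
so edges are named by their upper ends. -/

/-- The tree in which the vertex `v` has `ξ v` children. -/
def treeOf (ξ : List ℕ → ℕ) : Set (List ℕ) := {u | ∀ v i, v ++ [i] <+: u → i < ξ v}

/-- `L(T)`: the vertices without children. -/
def leaves (T : Set (List ℕ)) : Set (List ℕ) := {u ∈ T | ∀ i, u ++ [i] ∉ T}

/-- `N(T)`: the vertices (other than `⋆`) that are not leaves. -/
def nodes (T : Set (List ℕ)) : Set (List ℕ) := T \ leaves T

/-- The offspring distribution `(δ₀ + δ₂) / 2`. -/
def offspringLaw : Measure ℕ :=
  (2 : ℝ≥0∞)⁻¹ • Measure.dirac 0 + (2 : ℝ≥0∞)⁻¹ • Measure.dirac 2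

/-- The offspring numbers `ξ v` are i.i.d. with law `(δ₀ + δ₂) / 2`, so that
`ω ↦ treeOf (ξ · ω)` is a binary critical Galton-Watson tree. -/
structure IsCriticalBinaryGW {Ω : Type*} [MeasurableSpace Ω] (P : Measure Ω)
    (ξ : List ℕ → Ω → ℕ) : Prop where
  measurable : ∀ v, Measurable (ξ v)
  law : ∀ v, P.map (ξ v) = offspringLaw
  indep : iIndepFun ξ P

/-! ### Edge lengths and marks

`κ v` is the length of the edge with upper end `v`. A point of the tree is a pair `(v, s)` with
`0 < s ≤ κ v`: the point of the edge with upper end `v` at distance `s` from its lower end. -/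

/-- The distance from `⋆` to the point `(v, s)`. -/
def distStar (κ : List ℕ → ℝ) (p : List ℕ × ℝ) : ℝ :=
  ∑ i ∈ Finset.range p.1.length, κ (p.1.take i) + p.2

/-- The branch `B(x)` joining `x` to `⋆`. -/
def branch (κ : List ℕ → ℝ) (x : List ℕ) : Set (List ℕ × ℝ) :=
  {p | p.1 <+: x ∧ 0 < p.2 ∧ p.2 ≤ κ p.1}

/-- The length of the part of the branch `B(x)` that lies in `A`. -/
def branchLength (κ : List ℕ → ℝ) (x : List ℕ) (A : Set (List ℕ × ℝ)) : ℝ≥0∞ :=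
  ∑ i ∈ Finset.range (x.length + 1),
    volume {s : ℝ | (x.take i, s) ∈ A ∩ branch κ x}

/-- A set of points is measurable if its trace on each edge is. -/
def MeasurablePoints (A : Set (List ℕ × ℝ)) : Prop :=
  ∀ v, MeasurableSet {s : ℝ | (v, s) ∈ A}

/-- The edge lengths `κ v` are i.i.d. with law `Exp(2)` and independent of the offspring
numbers `ξ`. -/
structure IsExpLengths {Ω : Type*} [MeasurableSpace Ω] (P : Measure Ω)
    (ξ : List ℕ → Ω → ℕ) (κ : List ℕ → Ω → ℝ) : Prop where
  measurable : ∀ v, Measurable (κ v)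
  law : ∀ v, P.map (κ v) = expMeasure 2
  indep : iIndepFun κ P
  indep_tree : IndepFun (fun ω v => ξ v ω) (fun ω v => κ v ω) P

/-- The sigma-algebra generated by the random tree `G` and the edge lengths `κ`. -/
abbrev sigmaTree {Ω : Type*} (G : Ω → Set (List ℕ)) (κ : List ℕ → Ω → ℝ) : MeasurableSpace Ω :=
  (⨆ v, MeasurableSpace.comap (fun ω => v ∈ G ω) inferInstance) ⊔
    ⨆ v, MeasurableSpace.comap (κ v) inferInstance

/-- Conditionally on the tree `G` and the edge lengths `κ`, the point processes `π x`, for `x`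
an internal node of `G`, are mutually independent Poisson processes with rate `1 / n` on the
branches `B(x)`: conditionally on `(G, κ)`, the numbers of points of `π x` in `A`, for finitely
many pairs `(x, A)` with the sets `A` belonging to the same `x` disjoint, are independent and
Poisson distributed with parameters `(1 / n) * length (A ∩ B(x))`. -/
structure IsPoissonMarks {Ω : Type*} [MeasurableSpace Ω] (P : Measure Ω) (n : ℕ)
    (G : Ω → Set (List ℕ)) (κ : List ℕ → Ω → ℝ)
    (π : List ℕ → Ω → Set (List ℕ × ℝ)) : Prop where
  subset_branch : ∀ x ω, x ∈ nodes (G ω) → π x ω ⊆ branch (fun v => κ v ω) x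
  measurable : ∀ x A, MeasurablePoints A → Measurable fun ω => (π x ω ∩ A).encard
  cond_law : ∀ (r : ℕ) (x : Fin r → List ℕ) (A : Fin r → Set (List ℕ × ℝ)) (m : Fin r → ℕ),
    (∀ j, MeasurablePoints (A j)) →
    (∀ i j, i ≠ j → x i = x j → Disjoint (A i) (A j)) →
    ∀ᵐ ω ∂P, (∀ j, x j ∈ nodes (G ω)) →
      (P⟦{ω' | ∀ j, (π (x j) ω' ∩ A j).encard = (m j : ℕ∞)} | sigmaTree G κ⟧) ω
        = ∏ j, (poissonMeasure
            ((branchLength (fun v => κ v ω) (x j) (A j)).toNNReal / n)).real {m j}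

/-! ### The pruning procedure -/

/-- A mark at the point `pos`, sent by the node `sender`. -/
structure Mark where
  sender : List ℕ
  pos : List ℕ × ℝ

/-- The marks sent by the internal nodes of `T`. -/
def marks (T : Set (List ℕ)) (π : List ℕ → Set (List ℕ × ℝ)) : Set Mark :=
  {m | m.sender ∈ nodes T ∧ m.pos ∈ π m.sender}

/-- The outcome for the marks in `M` when the tree is explored from the top, that is, by
decreasing distance to `⋆`. A mark `m` is still active when it is met, and is then useful
(`true`), if every mark `m'` met before it, above which the sender of `m` lies, is useless; it
has been deactivated, and is then useless (`false`), if the sender of `m` lies above a useful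
mark `m'` met before it. The vertex `x` lies above the point `(v, s)` iff `v` is a prefix of
`x`. -/
inductive Fate (κ : List ℕ → ℝ) (M : Set Mark) : Mark → Bool → Prop
  | useful (m : Mark) (hm : m ∈ M)
      (h : ∀ m' ∈ M, distStar κ m.pos < distStar κ m'.pos → m'.pos.1 <+: m.sender → Fate κ M m' false) :
      Fate κ M m true
  | useless (m m' : Mark) (hm : m ∈ M) (hm' : m' ∈ M)
      (hlt : distStar κ m.pos < distStar κ m'.pos) (habove : m'.pos.1 <+: m.sender)
      (h : Fate κ M m' true) :
      Fate κ M m false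

/-- The pruned tree: whatever lies above a useful mark is removed and replaced by a leaf. The
leaf created on an edge keeps the name of the upper end of this edge, so that a vertex `u` of
`T` remains iff there is no useful mark on the edges strictly below the one leading to `u`. -/
def prune (κ : List ℕ → ℝ) (π : List ℕ → Set (List ℕ × ℝ)) (T : Set (List ℕ)) :
    Set (List ℕ) :=
  {u ∈ T | ∀ m, Fate κ (marks T π) m true → m.pos.1 <+: u → m.pos.1 = u}

end

end ForestFire

/-!
A finite binary tree has one more leaf than internal nodes, so it is enough to count the internal
nodes of the pruned tree, the *survivors*. An edge is cut iff some survivor of the subtree above it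
sends a mark to it. Given the tree, an edge with `j` survivors above it has an `Exp(2)` length that
is independent of all that happens above it, and carries no mark of theirs with probability
`E[exp(-(j / n) * length)] = 2 / (2 + j / n)`. Since the tree is a single leaf or two independent
copies of itself joined at a root, with probability `1 / 2` each, the law `p` of the number of
leaves of the pruned tree satisfies
`(2 + (k - 1) / n) p k = ∑ p i * p (k - i)` for `k ≥ 2`. This is the equation of an equilibrium
divided by its total mass. Two solutions of it are ordered termwise like their first entries, and
they have the same sum, so they are equal; dividing `p` by its mean gives back the equilibrium.
-/

namespace ForestFire

/-! ### Finite binary trees as sets of words -/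

section Words

variable {A B : Finset (List ℕ)} {i : ℕ} {u : List ℕ}

/-- The words of `A` planted at the first child of the root and those of `B` planted at the
second. -/
def graft (A B : Finset (List ℕ)) : Finset (List ℕ) :=
  A.image (List.cons 0) ∪ B.image (List.cons 1)

@[simp]
theorem nil_notMem_graft : [] ∉ graft A B := by simp [graft]

@[simp]
theorem cons_mem_graft : i :: u ∈ graft A B ↔ i = 0 ∧ u ∈ A ∨ i = 1 ∧ u ∈ B := by
  simp [graft, and_comm, eq_comm]

theorem forall_mem_graft {p : List ℕ → Prop} :
    (∀ x ∈ graft A B, p x) ↔ (∀ x ∈ A, p (0 :: x)) ∧ ∀ x ∈ B, p (1 :: x) := by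
  simp only [graft, Finset.forall_mem_union, Finset.forall_mem_image]

theorem graft_subset_graft {A' B' : Finset (List ℕ)} (hA : A ⊆ A') (hB : B ⊆ B') :
    graft A B ⊆ graft A' B' :=
  Finset.union_subset_union (Finset.image_subset_image hA) (Finset.image_subset_image hB)

theorem card_graft : (graft A B).card = A.card + B.card := by
  have hdisj : Disjoint (A.image (List.cons 0)) (B.image (List.cons 1)) := by
    simp [Finset.disjoint_left]
  rw [graft, Finset.card_union_of_disjoint hdisj,
    Finset.card_image_of_injective _ List.cons_injective,
    Finset.card_image_of_injective _ List.cons_injective]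

theorem card_insert_nil_graft : (insert [] (graft A B)).card = A.card + B.card + 1 := by
  rw [Finset.card_insert_of_notMem nil_notMem_graft, card_graft]

theorem encard_eq_add_encard_preimage_cons {S : Set (List ℕ)} (hnil : [] ∉ S)
    (hcons : ∀ i u, i :: u ∈ S → i < 2) :
    S.encard = (List.cons 0 ⁻¹' S).encard + (List.cons 1 ⁻¹' S).encard := by
  have hsplit : S = List.cons 0 '' (List.cons 0 ⁻¹' S) ∪ List.cons 1 '' (List.cons 1 ⁻¹' S) := by
    ext (_ | ⟨_ | _ | i, u⟩)
    · simpa using hnil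
    · simp
    · simp
    · simpa using fun h => absurd (hcons _ _ h) (by lia)
  have hdisj :
      Disjoint (List.cons 0 '' (List.cons 0 ⁻¹' S)) (List.cons 1 '' (List.cons 1 ⁻¹' S)) := by
    simp [Set.disjoint_left]
  conv_lhs => rw [hsplit, Set.encard_union_eq hdisj, List.cons_injective.encard_image,
    List.cons_injective.encard_image]

end Words

section BinaryTree

variable {t l r : BinaryTree Unit} {a : Unit} {i : ℕ} {u : List ℕ}

/-- The words naming the internal nodes of a finite binary tree: `0` leads to the left subtree
and `1` to the right one. -/
def innerWords : BinaryTree Unit → Finset (List ℕ)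
  | .nil => ∅
  | .node _ l r => insert [] (graft (innerWords l) (innerWords r))

/-- The words naming the leaves of a finite binary tree. -/
def leafWords : BinaryTree Unit → Finset (List ℕ)
  | .nil => {[]}
  | .node _ l r => graft (leafWords l) (leafWords r)

/-- The words naming the vertices of a finite binary tree. -/
def words (t : BinaryTree Unit) : Finset (List ℕ) := innerWords t ∪ leafWords t

theorem words_nil : words .nil = {[]} := rfl

@[simp]
theorem nil_mem_words : [] ∈ words t := by cases t <;> simp [words, innerWords, leafWords]

@[simp]
theorem cons_mem_words_node :
    i :: u ∈ words (.node a l r) ↔ i = 0 ∧ u ∈ words l ∨ i = 1 ∧ u ∈ words r := by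
  simp only [words, innerWords, leafWords, Finset.mem_union, Finset.mem_insert, reduceCtorEq,
    cons_mem_graft, false_or]
  tauto

theorem card_innerWords (t : BinaryTree Unit) : (innerWords t).card = t.numNodes := by
  induction t with
  | nil => rfl
  | node _ l r hl hr => rw [innerWords, card_insert_nil_graft, hl, hr, BinaryTree.numNodes]

theorem card_leafWords (t : BinaryTree Unit) : (leafWords t).card = t.numNodes + 1 := by
  induction t with
  | nil => rfl
  | node _ l r hl hr => rw [leafWords, card_graft, hl, hr, BinaryTree.numNodes]; ring

theorem disjoint_innerWords_leafWords (t : BinaryTree Unit) :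
    Disjoint (innerWords t) (leafWords t) := by
  induction t with
  | nil => simp [innerWords]
  | node _ l r hl hr =>
    simp only [Finset.disjoint_left] at hl hr ⊢
    rintro (_ | ⟨i, u⟩) <;> simp only [innerWords, leafWords, Finset.mem_insert, cons_mem_graft,
      nil_notMem_graft, not_false_eq_true, implies_true, reduceCtorEq, false_or]
    rintro (⟨rfl, hu⟩ | ⟨rfl, hu⟩) <;> simp [hl, hr, hu]

theorem card_words (t : BinaryTree Unit) : (words t).card = 2 * t.numNodes + 1 := by
  rw [words, Finset.card_union_of_disjoint (disjoint_innerWords_leafWords t), card_innerWords,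
    card_leafWords]
  lia

theorem leaves_words (t : BinaryTree Unit) : leaves (words t : Set (List ℕ)) = leafWords t := by
  ext u
  induction t generalizing u with
  | nil => simp [leaves, words_nil, leafWords]
  | node _ l r hl hr =>
    simp only [leaves, Set.mem_ofPred_eq, Finset.mem_coe] at hl hr ⊢
    rcases u with _ | ⟨i, u⟩
    · simpa [leafWords] using ⟨0, by simp⟩
    · simp only [List.cons_append, cons_mem_words_node, leafWords, cons_mem_graft, ← hl, ← hr]
      rcases i with _ | _ | i <;> simp

theorem nodes_words (t : BinaryTree Unit) : nodes (words t : Set (List ℕ)) = innerWords t := by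
  rw [nodes, leaves_words, ← Finset.coe_sdiff, words,
    Finset.union_sdiff_cancel_right (disjoint_innerWords_leafWords t)]

theorem encard_leaves_words (t : BinaryTree Unit) :
    (leaves (words t : Set (List ℕ))).encard = (t.numNodes + 1 : ℕ) := by
  rw [leaves_words, Set.encard_coe_eq_coe_finsetCard, card_leafWords]

theorem words_injective : Function.Injective words := by
  intro t
  induction t with
  | nil =>
    rintro (_ | ⟨_, l', r'⟩) h
    · rfl
    · have : [0] ∈ words (.node () l' r') := by simp
      simp [← h, words_nil] at this
  | node _ l r hl hr =>
    rintro (_ | ⟨_, l', r'⟩) h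
    · have : [0] ∈ words (.node () l r) := by simp
      simp [h, words_nil] at this
    · have hcons : ∀ i u, i :: u ∈ words (.node () l r) ↔ i :: u ∈ words (.node () l' r') := by
        simp [h]
      rw [hl (a₂ := l') (Finset.ext fun u => by simpa using hcons 0 u),
        hr (a₂ := r') (Finset.ext fun u => by simpa using hcons 1 u)]

instance : Countable (BinaryTree Unit) := words_injective.countable

end BinaryTree

section TreeOf

variable {ξ : List ℕ → ℕ} {i : ℕ} {u : List ℕ}

theorem nil_mem_treeOf : [] ∈ treeOf ξ := by simp [treeOf]

theorem cons_mem_treeOf : i :: u ∈ treeOf ξ ↔ i < ξ [] ∧ u ∈ treeOf fun v => ξ (i :: v) := by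
  refine ⟨fun h => ⟨h [] i (by simp), fun v j hv => h (i :: v) j (by simpa using hv)⟩, ?_⟩
  rintro ⟨hi, hu⟩ (_ | ⟨k, v⟩) j hv
  · simp only [List.nil_append, List.cons_prefix_cons, List.nil_prefix, and_true] at hv
    exact hv ▸ hi
  · simp only [List.cons_append, List.cons_prefix_cons] at hv
    exact hv.1 ▸ hu v j hv.2

theorem treeOf_eq_words_node_iff {a : Unit} {l r : BinaryTree Unit} :
    treeOf ξ = words (.node a l r) ↔ ξ [] = 2 ∧
      treeOf (fun v => ξ (0 :: v)) = words l ∧ treeOf (fun v => ξ (1 :: v)) = words r := by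
  refine ⟨fun h => ?_, fun ⟨hroot, hl, hr⟩ => ?_⟩
  · have hmem : ∀ i u, (i < ξ [] ∧ u ∈ treeOf fun v => ξ (i :: v)) ↔
        i = 0 ∧ u ∈ words l ∨ i = 1 ∧ u ∈ words r := fun i u => by
      rw [← cons_mem_treeOf, h, Finset.mem_coe, cons_mem_words_node]
    have hroot : ξ [] = 2 := by
      have hlow : 1 < ξ [] := ((hmem 1 []).2 (.inr ⟨rfl, nil_mem_words⟩)).1
      have hhigh : ¬ 2 < ξ [] := fun h => by simpa using (hmem 2 []).1 ⟨h, nil_mem_treeOf⟩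
      lia
    refine ⟨hroot, Set.ext fun u => ?_, Set.ext fun u => ?_⟩
    · simpa [hroot] using hmem 0 u
    · simpa [hroot] using hmem 1 u
  · ext (_ | ⟨_ | _ | i, u⟩) <;> simp [nil_mem_treeOf, cons_mem_treeOf, hroot, hl, hr]

theorem treeOf_eq_words_iff {t : BinaryTree Unit} :
    treeOf ξ = words t ↔ (∀ x ∈ innerWords t, ξ x = 2) ∧ ∀ x ∈ leafWords t, ξ x = 0 := by
  induction t generalizing ξ with
  | nil =>
    simp only [innerWords, leafWords, words_nil, Finset.notMem_empty, false_imp_iff, implies_true,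
      Finset.mem_singleton, forall_eq, true_and, Finset.coe_singleton]
    refine ⟨fun h => Nat.eq_zero_of_not_pos fun hpos => ?_, fun h => ?_⟩
    · have : [0] ∈ treeOf ξ := cons_mem_treeOf.2 ⟨hpos, nil_mem_treeOf⟩
      simp [h] at this
    · ext (_ | ⟨i, u⟩)
      · simp [nil_mem_treeOf]
      · simp [cons_mem_treeOf, h]
  | node a l r hl hr =>
    simp only [treeOf_eq_words_node_iff, hl, hr, innerWords, leafWords, Finset.forall_mem_insert,
      forall_mem_graft]
    tauto

end TreeOf

/-! ### Cut edges and survivors -/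

section Fate

variable {κ : List ℕ → ℝ} {M : Set Mark} {m : Mark}

theorem Fate.mem {b : Bool} (h : Fate κ M m b) : m ∈ M := by
  cases h <;> assumption

theorem Fate.not_true_of_false (h : Fate κ M m false) : ¬ Fate κ M m true := by
  suffices ∀ m b, Fate κ M m b → ¬ Fate κ M m (!b) from this m false h
  intro m b h
  induction h with
  | useful m _ _ ih =>
    rintro (_ | ⟨_, m', _, hm', hlt, habove, h'⟩)
    exact ih m' hm' hlt habove h'
  | useless m m' _ hm' hlt habove _ ih =>
    rintro (⟨_, _, h'⟩ | _)
    exact ih (h' m' hm' hlt habove)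

theorem fate_true_or_false (hM : M.Finite) (hm : m ∈ M) : Fate κ M m true ∨ Fate κ M m false := by
  have hwf : M.WellFoundedOn fun a b => distStar κ b.pos < distStar κ a.pos :=
    hM.wellFoundedOn (r := (distStar κ ·.pos > distStar κ ·.pos))
  refine hwf.induction (P := fun m => Fate κ M m true ∨ Fate κ M m false) hm fun m hm ih => ?_
  by_cases h : ∀ m' ∈ M, distStar κ m.pos < distStar κ m'.pos → m'.pos.1 <+: m.sender →
      Fate κ M m' false
  · exact .inl (.useful _ hm h)
  · push Not at h
    obtain ⟨m', hm', hlt, habove, hfate⟩ := h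
    exact .inr (.useless _ m' hm hm' hlt habove ((ih m' hm' hlt).resolve_right hfate))

theorem Fate.exists_useful_of_not_useful (hM : M.Finite) (hm : m ∈ M) (h : ¬ Fate κ M m true) :
    ∃ m', Fate κ M m' true ∧ distStar κ m.pos < distStar κ m'.pos ∧ m'.pos.1 <+: m.sender := by
  rcases (fate_true_or_false hM hm).resolve_left h with _ | ⟨_, m', _, _, hlt, habove, h'⟩
  exact ⟨m', h', hlt, habove⟩

theorem distStar_lt_of_prefix_of_ne (hκ : ∀ v, 0 < κ v) {v u : List ℕ} {s s' : ℝ}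
    (hs : s ≤ κ v) (hs' : 0 < s') (hvu : v <+: u) (hne : v ≠ u) :
    distStar κ (v, s) < distStar κ (u, s') := by
  obtain ⟨w, rfl⟩ := hvu
  have hw : 0 < w.length := List.length_pos_of_ne_nil fun h => hne (by simp [h])
  have htake : ∀ i ≤ v.length, (v ++ w).take i = v.take i := fun i hi => by
    rw [List.take_append_of_le_length hi]
  calc distStar κ (v, s)
      ≤ ∑ i ∈ Finset.range (v.length + 1), κ ((v ++ w).take i) := by
        rw [distStar, Finset.sum_range_succ, htake _ le_rfl, List.take_length]
        gcongr with i hi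
        rw [htake i (Finset.mem_range.1 hi).le]
    _ ≤ ∑ i ∈ Finset.range (v ++ w).length, κ ((v ++ w).take i) :=
        Finset.sum_le_sum_of_subset_of_nonneg (by simp; lia) fun i _ _ => (hκ _).le
    _ < distStar κ (v ++ w, s') := lt_add_of_pos_right _ hs'

end Fate

section Cuts

/-- The tree `T` cut at the edges in `C`: whatever lies above an edge in `C` is removed, and the
upper end of the edge becomes a leaf. -/
def cutAt (C T : Set (List ℕ)) : Set (List ℕ) := {u ∈ T | ∀ v ∈ C, v <+: u → v = u}

/-- The edges carrying a useful mark. -/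
def cutEdges (κ : List ℕ → ℝ) (M : Set Mark) : Set (List ℕ) :=
  {v | ∃ m, Fate κ M m true ∧ m.pos.1 = v}

/-- The node `x` sends a mark on the edge with upper end `v`. -/
def SendsMark (π : List ℕ → Set (List ℕ × ℝ)) (x v : List ℕ) : Prop := ∃ s, (v, s) ∈ π x

/-- The recursive description of the set `C` of cut edges, given the nodes `N` and the relation
`R x v` saying that `x` sends a mark on the edge `v`: an edge belongs to `C` iff it carries a mark
sent by a node from which it is not separated by an edge in `C`. -/
def IsCutSet (N : Set (List ℕ)) (R : List ℕ → List ℕ → Prop) (C : Set (List ℕ)) : Prop :=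
  ∀ v, v ∈ C ↔ ∃ x ∈ N, v <+: x ∧ R x v ∧ ∀ u ∈ C, v <+: u → u <+: x → u = v

theorem prune_eq_cutAt (κ : List ℕ → ℝ) (π : List ℕ → Set (List ℕ × ℝ)) (T : Set (List ℕ)) :
    prune κ π T = cutAt (cutEdges κ (marks T π)) T := by
  ext u
  exact and_congr_right fun _ =>
    ⟨fun h v ⟨m, hm, hv⟩ => hv ▸ h m hm, fun h m hm => h _ ⟨m, hm, rfl⟩⟩

theorem isCutSet_cutEdges {κ : List ℕ → ℝ} (hκ : ∀ v, 0 < κ v) {T : Set (List ℕ)}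
    {π : List ℕ → Set (List ℕ × ℝ)} (hbranch : ∀ x ∈ nodes T, π x ⊆ branch κ x)
    (hfin : (marks T π).Finite) :
    IsCutSet (nodes T) (SendsMark π) (cutEdges κ (marks T π)) := by
  have hpos : ∀ m ∈ marks T π, m.pos ∈ branch κ m.sender := fun m hm => hbranch _ hm.1 hm.2
  have hlt : ∀ m ∈ marks T π, ∀ m' ∈ marks T π, m.pos.1 <+: m'.pos.1 → m.pos.1 ≠ m'.pos.1 →
      distStar κ m.pos < distStar κ m'.pos := fun m hm m' hm' =>
    distStar_lt_of_prefix_of_ne hκ (hpos m hm).2.2 (hpos m' hm').2.1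
  intro v
  constructor
  · rintro ⟨m, hm, rfl⟩
    refine ⟨m.sender, hm.mem.1, (hpos m hm.mem).1, ⟨m.pos.2, hm.mem.2⟩, ?_⟩
    rintro _ ⟨m', hm', rfl⟩ hvu hux
    by_contra hne
    exact (Fate.useless m m' hm.mem hm'.mem (hlt m hm.mem m' hm'.mem hvu (Ne.symm hne)) hux
      hm').not_true_of_false hm
  · rintro ⟨x, hx, hvx, ⟨s, hs⟩, hsep⟩
    by_contra hv
    have hm : ⟨x, v, s⟩ ∈ marks T π := ⟨hx, hs⟩
    obtain ⟨m', hm', hdist, hab⟩ :=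
      Fate.exists_useful_of_not_useful hfin hm fun h => hv ⟨_, h, rfl⟩
    have hne : m'.pos.1 ≠ v := fun h => hv ⟨m', hm', h⟩
    rcases List.prefix_or_prefix_of_prefix hvx hab with hvm | hmv
    · exact hne (hsep _ ⟨m', hm', rfl⟩ hvm hab)
    · exact hdist.not_gt (hlt m' hm'.mem _ hm hmv hne)

/-- The relation `R` between nodes and edges, restricted to the subtree planted at the `i`-th
child of the root. -/
def childRel (i : ℕ) (R : List ℕ → List ℕ → Prop) (x v : List ℕ) : Prop := R (i :: x) (i :: v)

variable {N C : Set (List ℕ)} {R : List ℕ → List ℕ → Prop}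

theorem IsCutSet.preimage_cons (h : IsCutSet N R C) (i : ℕ) :
    IsCutSet (List.cons i ⁻¹' N) (childRel i R) (List.cons i ⁻¹' C) := by
  intro v
  rw [Set.mem_preimage, h]
  constructor
  · rintro ⟨_, hx, ⟨w, rfl⟩, hR, hsep⟩
    exact ⟨v ++ w, hx, v.prefix_append w, hR, fun u hu hvu hux => by
      simpa using hsep (i :: u) hu (by simpa using hvu) (by simpa using hux)⟩
  · rintro ⟨x, hx, hvx, hR, hsep⟩
    refine ⟨i :: x, hx, by simpa using hvx, hR, ?_⟩
    rintro _ hu ⟨w, rfl⟩ hux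
    simpa using hsep (v ++ w) hu (v.prefix_append w) (by simpa using hux)

end Cuts

section Survivors

open Classical in
/-- The internal nodes of a finite binary tree that remain after the exploration has reached
`⋆`, where `R x v` says that the node `x` sends a mark on the edge with upper end `v`. -/
noncomputable def survivors :
    BinaryTree Unit → (List ℕ → List ℕ → Prop) → Finset (List ℕ)
  | .nil, _ => ∅
  | .node _ l r, R =>
    let W := insert [] (graft (survivors l (childRel 0 R)) (survivors r (childRel 1 R)))
    if ∀ x ∈ W, ¬ R x [] then W else ∅

/-- The internal nodes of the tree with subtrees `l` and `r` that remain when the exploration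
reaches the root, before the marks on the edge `(⋆, ∅)` are met. -/
noncomputable def rootSurvivors (l r : BinaryTree Unit) (R : List ℕ → List ℕ → Prop) :
    Finset (List ℕ) :=
  insert [] (graft (survivors l (childRel 0 R)) (survivors r (childRel 1 R)))

variable {t l r : BinaryTree Unit} {a : Unit} {C : Set (List ℕ)} {R : List ℕ → List ℕ → Prop}

open Classical in
theorem survivors_node :
    survivors (.node a l r) R =
      if ∀ x ∈ rootSurvivors l r R, ¬ R x [] then rootSurvivors l r R else ∅ := rfl

theorem card_rootSurvivors : (rootSurvivors l r R).card =
    (survivors l (childRel 0 R)).card + (survivors r (childRel 1 R)).card + 1 :=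
  card_insert_nil_graft

theorem preimage_cons_zero_innerWords :
    List.cons 0 ⁻¹' (innerWords (.node a l r) : Set (List ℕ)) = innerWords l := by
  ext u; simp [innerWords]

theorem preimage_cons_one_innerWords :
    List.cons 1 ⁻¹' (innerWords (.node a l r) : Set (List ℕ)) = innerWords r := by
  ext u; simp [innerWords]

theorem IsCutSet.left (h : IsCutSet (innerWords (.node a l r)) R C) :
    IsCutSet (innerWords l) (childRel 0 R) (List.cons 0 ⁻¹' C) :=
  preimage_cons_zero_innerWords ▸ h.preimage_cons 0

theorem IsCutSet.right (h : IsCutSet (innerWords (.node a l r)) R C) :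
    IsCutSet (innerWords r) (childRel 1 R) (List.cons 1 ⁻¹' C) :=
  preimage_cons_one_innerWords ▸ h.preimage_cons 1

theorem mem_rootSurvivors_iff
    (hl : ∀ y, y ∈ survivors l (childRel 0 R) ↔ y ∈ innerWords l ∧ ∀ u, 0 :: u ∈ C → ¬ u <+: y)
    (hr : ∀ y, y ∈ survivors r (childRel 1 R) ↔ y ∈ innerWords r ∧ ∀ u, 1 :: u ∈ C → ¬ u <+: y)
    {x : List ℕ} :
    x ∈ rootSurvivors l r R ↔ x ∈ innerWords (.node a l r) ∧ ∀ u ∈ C, u <+: x → u = [] := by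
  have hcons : ∀ i y, (∀ u ∈ C, u <+: i :: y → u = []) ↔ ∀ u, i :: u ∈ C → ¬ u <+: y := by
    refine fun i y => ⟨fun h u hu huy => by simpa using h _ hu (by simpa using huy),
      fun h u hu => ?_⟩
    rintro ⟨w, hw⟩
    by_contra hne
    obtain ⟨j, u, rfl⟩ := List.exists_cons_of_ne_nil hne
    obtain ⟨rfl, rfl⟩ := List.cons.inj hw
    exact h u hu (u.prefix_append w)
  rcases x with _ | ⟨i, y⟩
  · simp [rootSurvivors, innerWords]
  · simp only [rootSurvivors, innerWords, Finset.mem_insert, reduceCtorEq, cons_mem_graft, false_or,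
      hcons, hl, hr]
    constructor
    · rintro (⟨rfl, hy, hC⟩ | ⟨rfl, hy, hC⟩)
      exacts [⟨.inl ⟨rfl, hy⟩, hC⟩, ⟨.inr ⟨rfl, hy⟩, hC⟩]
    · rintro ⟨⟨rfl, hy⟩ | ⟨rfl, hy⟩, hC⟩
      exacts [.inl ⟨rfl, hy, hC⟩, .inr ⟨rfl, hy, hC⟩]

theorem IsCutSet.mem_survivors_iff (h : IsCutSet (innerWords t) R C) {x : List ℕ} :
    x ∈ survivors t R ↔ x ∈ innerWords t ∧ ∀ u ∈ C, ¬ u <+: x := by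
  induction t generalizing R C x with
  | nil => simp [survivors, innerWords]
  | node a l r hl hr =>
    have hroot : ∀ x, x ∈ rootSurvivors l r R ↔
        x ∈ innerWords (.node a l r) ∧ ∀ u ∈ C, u <+: x → u = [] := fun x =>
      mem_rootSurvivors_iff (fun y => hl h.left) (fun y => hr h.right)
    have hnil : [] ∈ C ↔ ∃ x ∈ rootSurvivors l r R, R x [] := by
      simp only [h [], hroot, Finset.mem_coe, List.nil_prefix, true_and, forall_const, and_assoc,
        and_comm (a := R _ _)]
    rw [survivors_node]
    split_ifs with hR
    · have hC : [] ∉ C := fun hC => by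
        obtain ⟨x, hx, hxR⟩ := hnil.1 hC
        exact hR x hx hxR
      rw [hroot]
      exact and_congr_right fun _ => forall₂_congr fun u hu =>
        forall_congr' fun _ => iff_false_intro fun h => hC (h ▸ hu)
    · push Not at hR
      simpa using fun _ => ⟨[], hnil.2 hR, List.nil_prefix⟩

theorem IsCutSet.survivors_node_eq_empty (h : IsCutSet (innerWords (.node a l r)) R C)
    (hC : [] ∈ C) : survivors (.node a l r) R = ∅ :=
  Finset.eq_empty_of_forall_notMem fun _ hx =>
    (h.mem_survivors_iff.1 hx).2 [] hC List.nil_prefix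

theorem IsCutSet.survivors_node_eq_rootSurvivors (h : IsCutSet (innerWords (.node a l r)) R C)
    (hC : [] ∉ C) : survivors (.node a l r) R = rootSurvivors l r R := by
  have hmem : [] ∈ survivors (.node a l r) R :=
    h.mem_survivors_iff.2 ⟨by simp [innerWords], fun u hu hnil => hC (List.prefix_nil.1 hnil ▸ hu)⟩
  rw [survivors_node] at hmem ⊢
  split_ifs at hmem ⊢ <;> simp_all

theorem cutAt_eq_singleton_nil {T : Set (List ℕ)} (hT : [] ∈ T) (hC : [] ∈ C) :
    cutAt C T = {[]} := by
  ext u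
  refine ⟨fun hu => (hu.2 [] hC List.nil_prefix).symm, ?_⟩
  rintro rfl
  exact ⟨hT, fun v _ hv => List.prefix_nil.1 hv⟩

theorem preimage_cons_leaves (i : ℕ) (T : Set (List ℕ)) :
    List.cons i ⁻¹' leaves T = leaves (List.cons i ⁻¹' T) := rfl

theorem preimage_cons_cutAt (hC : [] ∉ C) (i : ℕ) (T : Set (List ℕ)) :
    List.cons i ⁻¹' cutAt C T = cutAt (List.cons i ⁻¹' C) (List.cons i ⁻¹' T) := by
  ext u
  refine and_congr_right fun _ => ⟨fun h v hv hvu => ?_, fun h v hv hvu => ?_⟩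
  · simpa using h (i :: v) hv (by simpa using hvu)
  · obtain ⟨j, v, rfl⟩ := List.exists_cons_of_ne_nil fun hnil => hC (hnil ▸ hv)
    obtain ⟨rfl, hprefix⟩ := List.cons_prefix_cons.1 hvu
    rw [h v hv hprefix]

theorem leaves_singleton_nil : leaves {([] : List ℕ)} = {[]} := by
  ext; simp +contextual [leaves]

theorem encard_leaves_cutAt_node (hC : [] ∉ C) :
    (leaves (cutAt C (words (.node a l r)))).encard =
      (leaves (cutAt (List.cons 0 ⁻¹' C) (words l))).encard +
        (leaves (cutAt (List.cons 1 ⁻¹' C) (words r))).encard := by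
  have hl : List.cons 0 ⁻¹' (words (.node a l r) : Set (List ℕ)) = words l := by ext; simp
  have hr : List.cons 1 ⁻¹' (words (.node a l r) : Set (List ℕ)) = words r := by ext; simp
  have hzero : [0] ∈ cutAt C (words (.node a l r)) := by
    have : [] ∈ List.cons 0 ⁻¹' cutAt C (words (.node a l r)) := by
      rw [preimage_cons_cutAt hC, hl]
      exact ⟨nil_mem_words, fun v _ hv => List.prefix_nil.1 hv⟩
    exact this
  rw [encard_eq_add_encard_preimage_cons (fun hnil => hnil.2 0 hzero) fun i u hu => ?_]
  · simp only [preimage_cons_leaves, preimage_cons_cutAt hC, hl, hr]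
  · rcases cons_mem_words_node.1 hu.1.1 with ⟨rfl, _⟩ | ⟨rfl, _⟩ <;> decide

theorem IsCutSet.encard_leaves_cutAt (h : IsCutSet (innerWords t) R C) :
    (leaves (cutAt C (words t))).encard = (survivors t R).card + 1 := by
  induction t generalizing R C with
  | nil =>
    have hcut : cutAt C (words .nil) = {[]} := by
      ext u
      simp +contextual [cutAt, words_nil]
    simp [hcut, leaves_singleton_nil, survivors]
  | node a l r hl hr =>
    by_cases hC : [] ∈ C
    · simp [cutAt_eq_singleton_nil (Finset.mem_coe.2 nil_mem_words) hC, leaves_singleton_nil,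
        h.survivors_node_eq_empty hC]
    · rw [encard_leaves_cutAt_node hC, hl h.left, hr h.right,
        h.survivors_node_eq_rootSurvivors hC, card_rootSurvivors]
      push_cast
      ring

theorem encard_leaves_prune {κ : List ℕ → ℝ} (hκ : ∀ v, 0 < κ v)
    {π : List ℕ → Set (List ℕ × ℝ)} (hbranch : ∀ x ∈ innerWords t, π x ⊆ branch κ x)
    (hfin : ∀ x ∈ innerWords t, (π x).Finite) :
    (leaves (prune κ π (words t))).encard = (survivors t (SendsMark π)).card + 1 := by
  have hmarks : (marks (words t) π).Finite := by
    refine ((innerWords t).finite_toSet.biUnion fun x hx => (hfin x hx).image (Mark.mk x)).subset ?_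
    rintro ⟨x, p⟩ ⟨hx, hp⟩
    rw [nodes_words] at hx
    exact Set.mem_biUnion hx ⟨p, hp, rfl⟩
  have hcut := isCutSet_cutEdges hκ (T := words t) (by simpa [nodes_words] using hbranch) hmarks
  rw [nodes_words] at hcut
  rw [prune_eq_cutAt, hcut.encard_leaves_cutAt]

end Survivors

/-! ### The law of the number of survivors -/

section Shape

/-- The probability that a critical binary Galton-Watson tree has the shape `t`. -/
noncomputable def weight (t : BinaryTree Unit) : ℝ≥0∞ := (2 ^ (2 * t.numNodes + 1))⁻¹

theorem weight_ne_zero (t : BinaryTree Unit) : weight t ≠ 0 := by simp [weight]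

theorem weight_node (a : Unit) (l r : BinaryTree Unit) :
    weight (.node a l r) = 2⁻¹ * (weight l * weight r) := by
  simp only [weight, BinaryTree.numNodes]
  rw [← ENNReal.mul_inv (by simp) (by simp), ← ENNReal.mul_inv (by simp) (by simp)]
  congr 1
  ring

theorem tsum_binaryTree (f : BinaryTree Unit → ℝ≥0∞) :
    ∑' t, f t = f .nil + ∑' p : BinaryTree Unit × BinaryTree Unit, f (.node () p.1 p.2) := by
  have hinj : Function.Injective fun p : BinaryTree Unit × BinaryTree Unit =>
      BinaryTree.node () p.1 p.2 := by
    rintro ⟨l, r⟩ ⟨l', r'⟩ h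
    simpa using h
  have hrange : ({.nil} : Set (BinaryTree Unit))ᶜ =
      Set.range fun p : BinaryTree Unit × BinaryTree Unit => BinaryTree.node () p.1 p.2 := by
    ext t
    cases t <;> simp
  rw [← ENNReal.summable.tsum_add_tsum_compl (s := {.nil}) ENNReal.summable, hrange,
    tsum_range f hinj, tsum_singleton]

theorem tsum_weight_height_lt_le_one (h : ℕ) :
    ∑' t : BinaryTree Unit, (if t.height < h then weight t else 0) ≤ 1 := by
  induction h with
  | zero => simp
  | succ h ih =>
    set f : BinaryTree Unit → ℝ≥0∞ := fun t => if t.height < h then weight t else 0 with hf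
    have hnode : ∀ l r : BinaryTree Unit,
        (if (BinaryTree.node () l r).height < h + 1 then weight (.node () l r) else 0)
          = 2⁻¹ * (f l * f r) := fun l r => by
      by_cases hl : l.height < h <;> by_cases hr : r.height < h <;>
        simp [hf, BinaryTree.height, weight_node, hl, hr]
    calc ∑' t : BinaryTree Unit, (if t.height < h + 1 then weight t else 0)
        = 2⁻¹ + 2⁻¹ * ((∑' t, f t) * ∑' t, f t) := by
          simp_rw [tsum_binaryTree (fun t => if t.height < h + 1 then weight t else 0), hnode,
            ENNReal.tsum_mul_left, ENNReal.tsum_prod', ENNReal.tsum_mul_left,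
            ENNReal.tsum_mul_right]
          simp [BinaryTree.height, weight]
      _ ≤ 2⁻¹ + 2⁻¹ * (1 * 1) := by gcongr
      _ = 1 := by rw [mul_one, mul_one, ENNReal.inv_two_add_inv_two]

theorem tsum_weight : ∑' t, weight t = 1 := by
  have hle : ∑' t, weight t ≤ 1 := by
    refine ENNReal.tsum_eq_iSup_sum.trans_le (iSup_le fun s => ?_)
    calc ∑ t ∈ s, weight t
        = ∑ t ∈ s, if t.height < s.sup BinaryTree.height + 1 then weight t else 0 :=
          Finset.sum_congr rfl fun t ht => by
            rw [if_pos (Nat.lt_succ_of_le (Finset.le_sup ht))]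
      _ ≤ ∑' t : BinaryTree Unit, if t.height < s.sup BinaryTree.height + 1 then weight t else 0 :=
          ENNReal.sum_le_tsum _
      _ ≤ 1 := tsum_weight_height_lt_le_one _
  have hrec : ∑' t, weight t = 2⁻¹ + 2⁻¹ * ((∑' t, weight t) * ∑' t, weight t) := by
    conv_lhs => rw [tsum_binaryTree]
    simp_rw [weight_node, ENNReal.tsum_mul_left, ENNReal.tsum_prod', ENNReal.tsum_mul_left,
      ENNReal.tsum_mul_right]
    simp [weight]
  lift ∑' t, weight t to ℝ≥0 using ne_top_of_le_ne_top ENNReal.one_ne_top hle with W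
  have hW : W = 2⁻¹ + 2⁻¹ * (W * W) := by
    rw [← ENNReal.coe_ofNat, ← ENNReal.coe_inv two_ne_zero] at hrec
    exact_mod_cast hrec
  have hsq : (W : ℝ) = 1 := by
    have hW' : (W : ℝ) = 2⁻¹ + 2⁻¹ * (W * W) := by simpa using congrArg NNReal.toReal hW
    nlinarith [hW', sq_nonneg ((W : ℝ) - 1)]
  exact_mod_cast hsq

/-- The law of the shape of a critical binary Galton-Watson tree. -/
noncomputable def shapeLaw : PMF (BinaryTree Unit) :=
  ⟨weight, tsum_weight ▸ ENNReal.summable.hasSum⟩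

theorem tsum_weight_numNodes_eq (k : ℕ) :
    ∑' t, (if t.numNodes = k then weight t else 0) = catalan k * (2 ^ (2 * k + 1))⁻¹ := by
  rw [tsum_eq_sum (s := BinaryTree.treesOfNumNodesEq k) fun t ht =>
    if_neg (BinaryTree.mem_treesOfNumNodesEq.not.1 ht),
    ← BinaryTree.treesOfNumNodesEq_card_eq_catalan, ← nsmul_eq_mul]
  refine Finset.sum_eq_card_nsmul fun t ht => ?_
  rw [BinaryTree.mem_treesOfNumNodesEq] at ht
  rw [if_pos ht, weight, ht]

end Shape

section SurvivorLaw

open unitInterval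

open Finset.HasAntidiagonal (antidiagonal)

variable {q : ℕ → I}

/-- The law of the number of survivors in a tree of shape `t`, if each edge is free of marks sent by
`k` given nodes with probability `q k`. -/
noncomputable def survivorLaw (q : ℕ → I) : BinaryTree Unit → PMF ℕ
  | .nil => PMF.pure 0
  | .node _ l r => (survivorLaw q l).bind fun a => (survivorLaw q r).bind fun b =>
      Ber(a + b + 1, 0, q (a + b + 1)).toPMF

theorem survivorLaw_node_succ (a : Unit) (l r : BinaryTree Unit) (j : ℕ) :
    survivorLaw q (.node a l r) (j + 1) = toNNReal (q (j + 1)) *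
      ∑ p ∈ antidiagonal j, survivorLaw q l p.1 * survivorLaw q r p.2 := by
  set ρ : ℝ≥0∞ := ↑(toNNReal (q (j + 1))) with hρ
  have hber : ∀ a b, Ber(a + b + 1, 0, q (a + b + 1)) {j + 1}
      = if a + b = j then ρ else 0 := fun a b => by
    rw [bernoulliMeasure_apply _ (measurableSet_singleton _)]
    split_ifs <;> simp_all
  calc survivorLaw q (.node a l r) (j + 1)
      = ∑' p : ℕ × ℕ, survivorLaw q l p.1 *
          (survivorLaw q r p.2 * if p.1 + p.2 = j then ρ else 0) := by
        simp_rw [ENNReal.tsum_prod', ENNReal.tsum_mul_left, survivorLaw, PMF.bind_apply,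
          Measure.toPMF_apply, hber]
    _ = ∑ p ∈ antidiagonal j, survivorLaw q l p.1 *
          (survivorLaw q r p.2 * if p.1 + p.2 = j then ρ else 0) :=
        tsum_eq_sum fun p hp => by simp [mt Finset.HasAntidiagonal.mem_antidiagonal.2 hp]
    _ = ρ *
          ∑ p ∈ antidiagonal j, survivorLaw q l p.1 * survivorLaw q r p.2 := by
        rw [Finset.mul_sum]
        refine Finset.sum_congr rfl fun p hp => ?_
        rw [if_pos (Finset.HasAntidiagonal.mem_antidiagonal.1 hp)]
        ring

/-- The law of the number of survivors in a critical binary Galton-Watson tree. -/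
noncomputable def prunedLaw (q : ℕ → I) : PMF ℕ := shapeLaw.bind (survivorLaw q)

theorem prunedLaw_apply (j : ℕ) : prunedLaw q j = ∑' t, weight t * survivorLaw q t j :=
  PMF.bind_apply _ _ _

theorem prunedLaw_succ (j : ℕ) :
    prunedLaw q (j + 1) = 2⁻¹ * toNNReal (q (j + 1)) *
      ∑ p ∈ antidiagonal j, prunedLaw q p.1 * prunedLaw q p.2 := by
  have hnil : survivorLaw q .nil (j + 1) = 0 := by simp [survivorLaw]
  simp_rw [prunedLaw_apply]
  rw [tsum_binaryTree, hnil, mul_zero, zero_add]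
  simp_rw [survivorLaw_node_succ, weight_node, ← ENNReal.tsum_mul_right, ← ENNReal.tsum_mul_left,
    ← ENNReal.tsum_prod (f := fun l r =>
      weight l * survivorLaw q l _ * (weight r * survivorLaw q r _))]
  rw [← Summable.tsum_finsetSum fun _ _ => ENNReal.summable, ← ENNReal.tsum_mul_left]
  refine tsum_congr fun p => ?_
  simp_rw [Finset.mul_sum]
  exact Finset.sum_congr rfl fun x _ => by ring

end SurvivorLaw

/-! ### The equilibrium -/

section Equilibrium

open unitInterval

open Finset.HasAntidiagonal (antidiagonal)

variable {n : ℕ} {c c' p p' : ℕ → ℝ}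

/-- The law of the mass of a typical particle at equilibrium, characterized by the normalized form
of `IsEquilibrium`. -/
structure IsTypicalMassLaw (n : ℕ) (p : ℕ → ℝ) : Prop where
  zero : p 0 = 0
  nonneg : ∀ k, 0 ≤ p k
  hasSum_one : HasSum p 1
  balance : ∀ k : ℕ, 2 ≤ k →
    (2 + ((k : ℝ) - 1) / n) * p k = ∑ i ∈ Finset.Ico 1 k, p i * p (k - i)

theorem two_add_div_pos {k : ℕ} (hk : 1 ≤ k) : 0 < 2 + ((k : ℝ) - 1) / n := by
  have : 0 ≤ (k : ℝ) - 1 := sub_nonneg.2 (by exact_mod_cast hk)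
  positivity

theorem IsTypicalMassLaw.le_of_one_le (hp : IsTypicalMassLaw n p) (hp' : IsTypicalMassLaw n p')
    (h : p 1 ≤ p' 1) (k : ℕ) : p k ≤ p' k := by
  induction k using Nat.strong_induction_on with
  | _ k ih =>
    match k with
    | 0 => rw [hp.zero, hp'.zero]
    | 1 => exact h
    | k + 2 =>
      refine le_of_mul_le_mul_left ?_ (two_add_div_pos (n := n) (k := k + 2) (by lia))
      rw [hp.balance _ (by lia), hp'.balance _ (by lia)]
      refine Finset.sum_le_sum fun i hi => ?_
      rw [Finset.mem_Ico] at hi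
      exact mul_le_mul (ih i hi.2) (ih _ (by lia)) (hp.nonneg _) (hp'.nonneg _)

theorem eq_of_hasSum_of_le {ι : Type*} {f g : ι → ℝ} {s : ℝ} (hf : HasSum f s) (hg : HasSum g s)
    (h : ∀ i, f i ≤ g i) : f = g := by
  have hsub := hg.sub hf
  rw [sub_self, hasSum_zero_iff_of_nonneg fun i => sub_nonneg.2 (h i)] at hsub
  exact funext fun i => (sub_eq_zero.1 (congrFun hsub i)).symm

theorem IsTypicalMassLaw.unique (hp : IsTypicalMassLaw n p) (hp' : IsTypicalMassLaw n p') :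
    p = p' := by
  rcases le_total (p 1) (p' 1) with h | h
  · exact eq_of_hasSum_of_le hp.hasSum_one hp'.hasSum_one (hp.le_of_one_le hp' h)
  · exact (eq_of_hasSum_of_le hp'.hasSum_one hp.hasSum_one (hp'.le_of_one_le hp h)).symm

theorem sum_Ico_one_mul_eq_sum_antidiagonal (p : ℕ → ℝ) (j : ℕ) :
    ∑ i ∈ Finset.Ico 1 (j + 2), p i * p (j + 2 - i)
      = ∑ x ∈ antidiagonal j, p (x.1 + 1) * p (x.2 + 1) := by
  rw [Finset.sum_Ico_eq_sum_range, Finset.Nat.sum_antidiagonal_eq_sum_range_succ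
    (f := fun a b => p (a + 1) * p (b + 1))]
  refine Finset.sum_congr (by simp) fun i hi => ?_
  rw [Finset.mem_range] at hi
  rw [show j + 2 - (1 + i) = j - i + 1 by lia, add_comm 1 i]

theorem IsTypicalMassLaw.summable_mul (hp : IsTypicalMassLaw n p) (hn : 1 ≤ n) :
    Summable fun k : ℕ => (k : ℝ) * p k := by
  have hshift : Summable fun k => p (k + 1) := (summable_nat_add_iff 1).2 hp.hasSum_one.summable
  have hconv : Summable fun j => ∑ x ∈ antidiagonal j, p (x.1 + 1) * p (x.2 + 1) :=
    summable_sum_mul_antidiagonal_of_summable_mul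
      (f := fun k => p (k + 1)) (g := fun k => p (k + 1))
      (hshift.mul_of_nonneg hshift (fun k => hp.nonneg (k + 1)) fun k => hp.nonneg (k + 1))
  rw [← summable_nat_add_iff 2]
  refine .of_nonneg_of_le (fun j => mul_nonneg (Nat.cast_nonneg _) (hp.nonneg _)) (fun j => ?_)
    (hconv.mul_left (n : ℝ))
  have hn' : (1 : ℝ) ≤ n := by exact_mod_cast hn
  calc ((j + 2 : ℕ) : ℝ) * p (j + 2)
      ≤ (n * (2 + (((j + 2 : ℕ) : ℝ) - 1) / n)) * p (j + 2) := by
        refine mul_le_mul_of_nonneg_right ?_ (hp.nonneg _)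
        rw [mul_add, mul_div_cancel₀ _ (by positivity)]
        linarith
    _ = n * ∑ x ∈ antidiagonal j, p (x.1 + 1) * p (x.2 + 1) := by
        rw [mul_assoc, hp.balance _ (by lia), sum_Ico_one_mul_eq_sum_antidiagonal]

theorem IsTypicalMassLaw.isEquilibrium_div (hp : IsTypicalMassLaw n p) (hn : 1 ≤ n) :
    IsEquilibrium n fun k => p k / ∑' k : ℕ, (k : ℝ) * p k := by
  have hsum := hp.summable_mul hn
  set E := ∑' k : ℕ, (k : ℝ) * p k with hE
  have hE_pos : 0 < E := by
    refine one_pos.trans_le ?_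
    rw [hE, ← hp.hasSum_one.tsum_eq]
    refine hp.hasSum_one.summable.tsum_le_tsum (fun k => ?_) hsum
    rcases k with _ | k
    · simp [hp.zero]
    · exact le_mul_of_one_le_left (hp.nonneg _) (by simp)
  have hmoment : moment 0 (fun k => p k / E) = 1 / E := by
    simp only [moment, pow_zero, one_mul, tsum_div_const, hp.hasSum_one.tsum_eq]
  refine ⟨by simp [hp.zero], fun k => div_nonneg (hp.nonneg k) hE_pos.le, ?_, fun k hk => ?_⟩
  · simpa only [mul_div_assoc, ← hE, div_self hE_pos.ne'] using hsum.hasSum.div_const E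
  · simp_rw [div_mul_div_comm, ← Finset.sum_div, ← hp.balance k hk, hmoment]
    field_simp

theorem moment_zero (c : ℕ → ℝ) : moment 0 c = ∑' k, c k := by simp [moment]

theorem IsEquilibrium.summable (hc : IsEquilibrium n c) : Summable c := by
  refine hc.mass.summable.of_nonneg_of_le hc.nonneg fun k => ?_
  rcases k with _ | k
  · simp [hc.zero]
  · exact le_mul_of_one_le_left (hc.nonneg _) (by simp)

theorem IsEquilibrium.moment_zero_pos (hc : IsEquilibrium n c) : 0 < moment 0 c := by
  rw [moment_zero]
  refine lt_of_le_of_ne (tsum_nonneg hc.nonneg) fun h => zero_ne_one (α := ℝ) ?_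
  have hc_zero := hc.summable.hasSum
  rw [← h, hasSum_zero_iff_of_nonneg hc.nonneg] at hc_zero
  simpa [hc_zero] using hc.mass.tsum_eq

theorem IsEquilibrium.isTypicalMassLaw (hc : IsEquilibrium n c) :
    IsTypicalMassLaw n fun k => c k / moment 0 c := by
  have hm := hc.moment_zero_pos
  refine ⟨by simp [hc.zero], fun k => div_nonneg (hc.nonneg k) hm.le, ?_, fun k hk => ?_⟩
  · have := hc.summable.hasSum.div_const (moment 0 c)
    rwa [← moment_zero, div_self hm.ne'] at this
  · simp_rw [div_mul_div_comm, ← Finset.sum_div, ← mul_div_assoc, hc.balance k hk]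
    field_simp

theorem IsEquilibrium.unique (hc : IsEquilibrium n c) (hc' : IsEquilibrium n c') : c = c' := by
  have hm := hc.moment_zero_pos
  have hm' := hc'.moment_zero_pos
  have hscale : ∀ k, c k = moment 0 c / moment 0 c' * c' k := fun k => by
    have hk := congrFun (hc.isTypicalMassLaw.unique hc'.isTypicalMassLaw) k
    field_simp at hk ⊢
    exact hk
  have hratio : moment 0 c / moment 0 c' = 1 := by
    have hmass := hc'.mass.mul_left (moment 0 c / moment 0 c')
    simp_rw [mul_left_comm, ← hscale, mul_one] at hmass
    exact hmass.unique hc.mass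
  exact funext fun k => by rw [hscale, hratio, one_mul]

/-- The law of the number of leaves of the pruned tree, which has one leaf more than it has
internal nodes. -/
noncomputable def leafLaw (q : ℕ → I) : ℕ → ℝ
  | 0 => 0
  | j + 1 => (prunedLaw q j).toReal

theorem hasSum_leafLaw (q : ℕ → I) : HasSum (leafLaw q) 1 := by
  rw [← hasSum_nat_add_iff' 1]
  have h := ENNReal.hasSum_toReal (f := prunedLaw q) (by rw [PMF.tsum_coe]; simp)
  rw [← ENNReal.tsum_toReal_eq (fun j => PMF.apply_ne_top _ _), PMF.tsum_coe] at h
  simpa [leafLaw] using h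

theorem leafLaw_add_two (q : ℕ → I) (j : ℕ) :
    leafLaw q (j + 2) =
      2⁻¹ * q (j + 1) * ∑ x ∈ antidiagonal j, leafLaw q (x.1 + 1) * leafLaw q (x.2 + 1) := by
  rw [leafLaw, prunedLaw_succ, ENNReal.toReal_mul, ENNReal.toReal_mul, ENNReal.toReal_sum
    fun p _ => ENNReal.mul_ne_top (PMF.apply_ne_top _ _) (PMF.apply_ne_top _ _)]
  simp [leafLaw, ENNReal.toReal_mul]

/-- The probability `2 / (2 + j / n)` that an edge with `Exp(2)` length carries no mark sent by
`j` given nodes at rate `1 / n`. -/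
noncomputable def keepProb (n j : ℕ) : I :=
  ⟨2 / (2 + j / n), by positivity, div_le_one_of_le₀ (le_add_of_nonneg_right (by positivity))
    (by positivity)⟩

theorem isTypicalMassLaw_leafLaw (n : ℕ) : IsTypicalMassLaw n (leafLaw (keepProb n)) := by
  refine ⟨rfl, fun k => ?_, hasSum_leafLaw _, fun k hk => ?_⟩
  · cases k <;> simp [leafLaw]
  · obtain ⟨j, rfl⟩ := Nat.exists_eq_add_of_le' hk
    have hpos := two_add_div_pos (n := n) (k := j + 2) (by lia)
    have hkeep : (keepProb n (j + 1) : ℝ) = 2 / (2 + (((j + 2 : ℕ) : ℝ) - 1) / n) := by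
      rw [keepProb]
      push_cast
      ring
    rw [sum_Ico_one_mul_eq_sum_antidiagonal, leafLaw_add_two, hkeep, ← mul_assoc]
    convert one_mul _
    field_simp

theorem IsEquilibrium.div_moment_zero_eq_leafLaw (hc : IsEquilibrium n c) (k : ℕ) :
    c k / moment 0 c = leafLaw (keepProb n) k :=
  congrFun (hc.isTypicalMassLaw.unique (isTypicalMassLaw_leafLaw n)) k

end Equilibrium

/-! ### Independent marks on the edges -/

section IndependentMarks

open unitInterval

open Finset.HasAntidiagonal (antidiagonal)

variable {t s l r : BinaryTree Unit} {a : Unit} {i : ℕ} {v : List ℕ}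

theorem survivors_subset {R : List ℕ → List ℕ → Prop} : survivors t R ⊆ innerWords t := by
  induction t generalizing R with
  | nil => simp [survivors]
  | node a l r hl hr =>
    rw [survivors_node, rootSurvivors, innerWords]
    split_ifs
    · exact Finset.insert_subset_insert _ (graft_subset_graft hl hr)
    · exact Finset.empty_subset _

theorem rootSurvivors_subset {R : List ℕ → List ℕ → Prop} :
    rootSurvivors l r R ⊆ innerWords (.node a l r) :=
  Finset.insert_subset_insert _ (graft_subset_graft survivors_subset survivors_subset)

/-- The internal nodes of `t` above the edge with upper end `v`. -/
def nodesAbove (t : BinaryTree Unit) (v : List ℕ) : Finset (List ℕ) :=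
  (innerWords t).filter (v <+: ·)

theorem nodesAbove_nil : nodesAbove t [] = innerWords t := by simp [nodesAbove]

theorem nodesAbove_cons (hs : List.cons i ⁻¹' (innerWords t : Set (List ℕ)) = innerWords s) :
    nodesAbove t (i :: v) = (nodesAbove s v).image (List.cons i) := by
  have hmem : ∀ u, i :: u ∈ innerWords t ↔ u ∈ innerWords s := fun u => Set.ext_iff.1 hs u
  ext x
  rcases x with _ | ⟨j, u⟩
  · simp [nodesAbove]
  · by_cases hij : i = j
    · subst hij
      simp [nodesAbove, hmem]
    · simp [nodesAbove, hij]

variable {Ω : Type*} {M : Ω → List ℕ → List ℕ → Prop} {S : Finset (List ℕ)}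

/-- The event that no node of `S` sends a mark on the edge with upper end `v`. -/
def noMarks (M : Ω → List ℕ → List ℕ → Prop) (v : List ℕ) (S : Finset (List ℕ)) : Set Ω :=
  {ω | ∀ x ∈ S, ¬ M ω x v}

theorem noMarks_childRel :
    noMarks (fun ω => childRel i (M ω)) v S = noMarks M (i :: v) (S.image (List.cons i)) := by
  simp [noMarks, childRel]

/-- The events `noMarks M v S` for the sets `S` of nodes of `t` above the edge `v`. -/
def noMarksEvents (M : Ω → List ℕ → List ℕ → Prop) (t : BinaryTree Unit) (v : List ℕ) :
    Set (Set Ω) :=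
  {A | ∃ S ⊆ nodesAbove t v, noMarks M v S = A}

theorem isPiSystem_noMarksEvents : IsPiSystem (noMarksEvents M t v) := by
  rintro _ ⟨S, hS, rfl⟩ _ ⟨S', hS', rfl⟩ -
  refine ⟨S ∪ S', Finset.union_subset hS hS', ?_⟩
  ext ω
  simp [noMarks, or_imp, forall_and]

/-- The information on the marks on the edge with upper end `v`. -/
abbrev edgeAlgebra (M : Ω → List ℕ → List ℕ → Prop) (t : BinaryTree Unit) (v : List ℕ) :
    MeasurableSpace Ω :=
  .generateFrom (noMarksEvents M t v)

theorem edgeAlgebra_childRel (hs : List.cons i ⁻¹' (innerWords t : Set (List ℕ)) = innerWords s) :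
    edgeAlgebra (fun ω => childRel i (M ω)) s v = edgeAlgebra M t (i :: v) := by
  refine congrArg MeasurableSpace.generateFrom (Set.ext fun A => ?_)
  simp only [noMarksEvents, nodesAbove_cons hs, noMarks_childRel, Finset.subset_image_iff,
    Set.mem_ofPred_eq, exists_exists_and_eq_and]

/-- The information on the marks on all edges of `t`. -/
abbrev marksAlgebra (M : Ω → List ℕ → List ℕ → Prop) (t : BinaryTree Unit) : MeasurableSpace Ω :=
  ⨆ v, edgeAlgebra M t v

theorem marksAlgebra_childRel (hs : List.cons i ⁻¹' (innerWords t : Set (List ℕ)) = innerWords s) :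
    marksAlgebra (fun ω => childRel i (M ω)) s =
      ⨆ v ∈ Set.range (List.cons i), edgeAlgebra M t v := by
  rw [iSup_range]
  exact iSup_congr fun _ => edgeAlgebra_childRel hs

theorem marksAlgebra_childRel_le
    (hs : List.cons i ⁻¹' (innerWords t : Set (List ℕ)) = innerWords s) :
    marksAlgebra (fun ω => childRel i (M ω)) s ≤ marksAlgebra M t :=
  (marksAlgebra_childRel hs).trans_le (iSup₂_le_iSup _ _)

theorem measurableSet_noMarks (hS : S ⊆ nodesAbove t v) :
    MeasurableSet[edgeAlgebra M t v] (noMarks M v S) :=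
  MeasurableSpace.measurableSet_generateFrom ⟨S, hS, rfl⟩

local instance : MeasurableSpace (Finset (List ℕ)) := ⊤

theorem measurable_rootSurvivors {m : MeasurableSpace Ω}
    (hl : Measurable[m] fun ω => survivors l (childRel 0 (M ω)))
    (hr : Measurable[m] fun ω => survivors r (childRel 1 (M ω))) :
    Measurable[m] fun ω => rootSurvivors l r (M ω) :=
  (measurable_of_countable fun p : Finset (List ℕ) × Finset (List ℕ) =>
    insert [] (graft p.1 p.2)).comp (hl.prodMk hr)

theorem measurable_survivors : Measurable[marksAlgebra M t] fun ω => survivors t (M ω) := by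
  induction t generalizing M with
  | nil => exact measurable_const
  | node a l r hl hr =>
    have hroot : Measurable[marksAlgebra M (.node a l r)] fun ω => rootSurvivors l r (M ω) :=
      measurable_rootSurvivors
        (hl.mono (marksAlgebra_childRel_le preimage_cons_zero_innerWords) le_rfl)
        (hr.mono (marksAlgebra_childRel_le preimage_cons_one_innerWords) le_rfl)
    simp only [survivors_node]
    refine Measurable.ite ?_ hroot measurable_const
    have hkeep : {ω | ∀ x ∈ rootSurvivors l r (M ω), ¬ M ω x []} =
        ⋃ D ∈ (innerWords (.node a l r)).powerset,
          (fun ω => rootSurvivors l r (M ω)) ⁻¹' {D} ∩ noMarks M [] D := by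
      ext ω
      simp [noMarks, rootSurvivors_subset]
    rw [hkeep]
    refine Finset.measurableSet_biUnion _ fun D hD =>
      (hroot (measurableSet_singleton D)).inter (le_iSup (edgeAlgebra M _) [] _ ?_)
    exact measurableSet_noMarks (nodesAbove_nil.symm ▸ Finset.mem_powerset.1 hD)

variable [MeasurableSpace Ω] {μ : Measure Ω} {q : ℕ → I}

/-- The marks on different edges of `t` are independent, and an edge is free of marks sent by `k`
given nodes above it with probability `q k`. -/
structure HasIndepEdgeMarks (μ : Measure Ω) (q : ℕ → I) (M : Ω → List ℕ → List ℕ → Prop)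
    (t : BinaryTree Unit) : Prop where
  measurableSet : ∀ v, ∀ S ⊆ nodesAbove t v, MeasurableSet (noMarks M v S)
  measure_iInter : ∀ (V : Finset (List ℕ)) (S : List ℕ → Finset (List ℕ)),
    (∀ v ∈ V, S v ⊆ nodesAbove t v) →
      μ (⋂ v ∈ V, noMarks M v (S v)) = ∏ v ∈ V, (toNNReal (q (S v).card) : ℝ≥0∞)

namespace HasIndepEdgeMarks

theorem childRel (h : HasIndepEdgeMarks μ q M t)
    (hs : List.cons i ⁻¹' (innerWords t : Set (List ℕ)) = innerWords s) :
    HasIndepEdgeMarks μ q (fun ω => childRel i (M ω)) s := by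
  have hsub : ∀ v, ∀ S ⊆ nodesAbove s v, S.image (List.cons i) ⊆ nodesAbove t (i :: v) :=
    fun v S hS => nodesAbove_cons hs ▸ Finset.image_subset_image hS
  refine ⟨fun v S hS => noMarks_childRel ▸ h.measurableSet _ _ (hsub v S hS), fun V S hS => ?_⟩
  have hV := h.measure_iInter (V.image (List.cons i)) (fun u => (S u.tail).image (List.cons i))
    (by simpa using fun v hv => hsub v _ (hS v hv))
  rw [Finset.prod_image List.cons_injective.injOn] at hV
  simpa [noMarks_childRel, Finset.card_image_of_injective _ List.cons_injective] using hV

theorem isProbabilityMeasure (h : HasIndepEdgeMarks μ q M t) : IsProbabilityMeasure μ :=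
  ⟨by simpa using h.measure_iInter ∅ fun _ => ∅⟩

theorem measure_noMarks (h : HasIndepEdgeMarks μ q M t) (hS : S ⊆ nodesAbove t v) :
    μ (noMarks M v S) = toNNReal (q S.card) := by
  simpa [hS] using h.measure_iInter {v} fun _ => S

theorem edgeAlgebra_le (h : HasIndepEdgeMarks μ q M t) (v : List ℕ) :
    edgeAlgebra M t v ≤ ‹MeasurableSpace Ω› := by
  refine MeasurableSpace.generateFrom_le ?_
  rintro _ ⟨S, hS, rfl⟩
  exact h.measurableSet v S hS

theorem iIndep_edgeAlgebra (h : HasIndepEdgeMarks μ q M t) : iIndep (edgeAlgebra M t) μ := by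
  have := h.isProbabilityMeasure
  refine iIndepSets.iIndep h.edgeAlgebra_le (noMarksEvents M t)
    (fun _ => isPiSystem_noMarksEvents) (fun _ => rfl) ?_
  rw [iIndepSets_iff]
  intro V f hf
  choose! S hS hf using hf
  rw [Set.iInter₂_congr fun v hv => (hf v hv).symm, h.measure_iInter V S hS]
  exact Finset.prod_congr rfl fun v hv => by rw [← hf v hv, h.measure_noMarks (hS v hv)]

theorem measurable_survivors (h : HasIndepEdgeMarks μ q M t) :
    Measurable fun ω => survivors t (M ω) :=
  ForestFire.measurable_survivors.mono (iSup_le h.edgeAlgebra_le) le_rfl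

theorem indepFun_survivors (h : HasIndepEdgeMarks μ q M (.node a l r)) :
    IndepFun (fun ω => survivors l (ForestFire.childRel 0 (M ω)))
      (fun ω => survivors r (ForestFire.childRel 1 (M ω))) μ := by
  have hdisj : Disjoint (Set.range (List.cons 0)) (Set.range (List.cons 1)) := by
    simp [Set.disjoint_left]
  have hindep := indep_iSup_of_disjoint h.edgeAlgebra_le h.iIndep_edgeAlgebra hdisj
  rw [← marksAlgebra_childRel preimage_cons_zero_innerWords,
    ← marksAlgebra_childRel preimage_cons_one_innerWords] at hindep
  exact indep_of_indep_of_le_left (indep_of_indep_of_le_right hindep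
    ForestFire.measurable_survivors.comap_le) ForestFire.measurable_survivors.comap_le

theorem measurable_rootSurvivors (h : HasIndepEdgeMarks μ q M (.node a l r)) :
    Measurable fun ω => rootSurvivors l r (M ω) :=
  ForestFire.measurable_rootSurvivors
    (h.childRel preimage_cons_zero_innerWords).measurable_survivors
    (h.childRel preimage_cons_one_innerWords).measurable_survivors

theorem measure_rootSurvivors_inter_noMarks (h : HasIndepEdgeMarks μ q M (.node a l r))
    {D : Finset (List ℕ)} (hD : D ⊆ innerWords (.node a l r)) :
    μ ((fun ω => rootSurvivors l r (M ω)) ⁻¹' {D} ∩ noMarks M [] D) =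
      μ ((fun ω => rootSurvivors l r (M ω)) ⁻¹' {D}) * toNNReal (q D.card) := by
  have hD' : D ⊆ nodesAbove (.node a l r) [] := nodesAbove_nil.symm ▸ hD
  set E : Set (List ℕ) := Set.range (List.cons 0) ∪ Set.range (List.cons 1) with hE
  have hroot : Measurable[⨆ v ∈ E, edgeAlgebra M (.node a l r) v]
      fun ω => rootSurvivors l r (M ω) := by
    refine ForestFire.measurable_rootSurvivors (ForestFire.measurable_survivors.mono ?_ le_rfl)
      (ForestFire.measurable_survivors.mono ?_ le_rfl)
    · exact (marksAlgebra_childRel preimage_cons_zero_innerWords).trans_le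
        (biSup_mono Set.subset_union_left)
    · exact (marksAlgebra_childRel preimage_cons_one_innerWords).trans_le
        (biSup_mono Set.subset_union_right)
  have hnil : MeasurableSet[⨆ v ∈ ({[]} : Set (List ℕ)), edgeAlgebra M (.node a l r) v]
      (noMarks M [] D) := by
    rw [iSup_singleton]
    exact measurableSet_noMarks hD'
  have hindep := indep_iSup_of_disjoint h.edgeAlgebra_le h.iIndep_edgeAlgebra
    (S := E) (T := {[]}) (by simp [hE])
  rw [(Indep_iff _ _ _).1 hindep _ _ (hroot (measurableSet_singleton D)) hnil,
    h.measure_noMarks hD']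

theorem measure_card_survivors_eq_add_one (h : HasIndepEdgeMarks μ q M (.node a l r)) (j : ℕ) :
    μ {ω | (survivors (.node a l r) (M ω)).card = j + 1} =
      toNNReal (q (j + 1)) * μ {ω | (rootSurvivors l r (M ω)).card = j + 1} := by
  set W : Ω → Finset (List ℕ) := fun ω => rootSurvivors l r (M ω) with hW
  set 𝒟 := (innerWords (.node a l r)).powersetCard (j + 1) with h𝒟
  have hsurvivors : {ω | (survivors (.node a l r) (M ω)).card = j + 1} =
      ⋃ D ∈ 𝒟, W ⁻¹' {D} ∩ noMarks M [] D := by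
    ext ω
    simp only [Set.mem_ofPred_eq, survivors_node, noMarks, h𝒟, Finset.mem_powersetCard]
    split_ifs with hkeep <;> simp_all [rootSurvivors_subset]
  have hroot : {ω | (W ω).card = j + 1} = ⋃ D ∈ 𝒟, W ⁻¹' {D} := by
    ext ω
    simp [hW, h𝒟, rootSurvivors_subset]
  have hmeas : ∀ D, MeasurableSet (W ⁻¹' {D}) := fun D =>
    h.measurable_rootSurvivors (measurableSet_singleton D)
  have hinter : ∀ D ∈ 𝒟, MeasurableSet (W ⁻¹' {D} ∩ noMarks M [] D) := fun D hD =>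
    (hmeas D).inter <| h.measurableSet [] D <|
      nodesAbove_nil.symm ▸ (Finset.mem_powersetCard.1 hD).1
  have hdisj : (𝒟 : Set (Finset (List ℕ))).PairwiseDisjoint fun D => W ⁻¹' {D} :=
    fun D _ D' _ hne => (Set.disjoint_singleton.2 hne).preimage W
  rw [hsurvivors, hroot, measure_biUnion_finset hdisj fun D _ => hmeas D, Finset.mul_sum,
    measure_biUnion_finset (hdisj.mono fun _ => Set.inter_subset_left) hinter]
  refine Finset.sum_congr rfl fun D hD => ?_
  obtain ⟨hD, hcard⟩ := Finset.mem_powersetCard.1 hD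
  rw [h.measure_rootSurvivors_inter_noMarks hD, hcard, mul_comm]

theorem measure_card_rootSurvivors (h : HasIndepEdgeMarks μ q M (.node a l r)) (j : ℕ) :
    μ {ω | (rootSurvivors l r (M ω)).card = j + 1} = ∑ p ∈ antidiagonal j,
      μ {ω | (survivors l (ForestFire.childRel 0 (M ω))).card = p.1} *
        μ {ω | (survivors r (ForestFire.childRel 1 (M ω))).card = p.2} := by
  set X : Ω → ℕ := fun ω => (survivors l (ForestFire.childRel 0 (M ω))).card with hX
  set Y : Ω → ℕ := fun ω => (survivors r (ForestFire.childRel 1 (M ω))).card with hY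
  have hXm : Measurable X := (measurable_of_countable Finset.card).comp
    (h.childRel preimage_cons_zero_innerWords).measurable_survivors
  have hYm : Measurable Y := (measurable_of_countable Finset.card).comp
    (h.childRel preimage_cons_one_innerWords).measurable_survivors
  have hXY : IndepFun X Y μ := h.indepFun_survivors.comp (measurable_of_countable Finset.card)
    (measurable_of_countable Finset.card)
  have hsplit : {ω | (rootSurvivors l r (M ω)).card = j + 1} =
      ⋃ p ∈ antidiagonal j, (fun ω => (X ω, Y ω)) ⁻¹' {p} := by
    ext ω
    simp [card_rootSurvivors, hX, hY]
  rw [hsplit, measure_biUnion_finset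
    (fun p _ p' _ hne => (Set.disjoint_singleton.2 hne).preimage _)
    fun p _ => hXm.prodMk hYm (measurableSet_singleton p)]
  refine Finset.sum_congr rfl fun p _ => ?_
  rw [← Set.singleton_prod_singleton (a := p.1), Set.mk_preimage_prod]
  exact hXY.measure_inter_preimage_eq_mul _ _ (measurableSet_singleton _)
    (measurableSet_singleton _)

end HasIndepEdgeMarks

theorem pmf_eq_of_forall_succ {p p' : PMF ℕ} (h : ∀ j, p (j + 1) = p' (j + 1)) : p = p' := by
  have hsum := p.tsum_coe.trans p'.tsum_coe.symm
  rw [tsum_eq_zero_add' (f := p) ENNReal.summable, tsum_eq_zero_add' (f := p') ENNReal.summable,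
    funext h] at hsum
  refine PMF.ext fun j => ?_
  cases j with
  | succ j => exact h j
  | zero =>
    refine (ENNReal.add_left_inj (ne_top_of_le_ne_top ENNReal.one_ne_top ?_)).1 hsum
    rw [← p'.tsum_coe]
    exact ENNReal.tsum_comp_le_tsum_of_injective (add_left_injective 1) _

theorem HasIndepEdgeMarks.measure_card_survivors (h : HasIndepEdgeMarks μ q M t) (j : ℕ) :
    μ {ω | (survivors t (M ω)).card = j} = survivorLaw q t j := by
  have := h.isProbabilityMeasure
  induction t generalizing M j with
  | nil => cases j <;> simp [survivors, survivorLaw]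
  | node a l r hl hr =>
    set X : Ω → ℕ := fun ω => (survivors (.node a l r) (M ω)).card
    have hXm : Measurable X :=
      (measurable_of_countable Finset.card).comp h.measurable_survivors
    have := Measure.isProbabilityMeasure_map (μ := μ) hXm.aemeasurable
    have hlaw : ∀ j, (μ.map X).toPMF j = μ {ω | X ω = j} := fun j => by
      rw [Measure.toPMF_apply, Measure.map_apply hXm (measurableSet_singleton j)]
      rfl
    rw [← hlaw]
    congr 1
    refine pmf_eq_of_forall_succ fun j => ?_
    rw [hlaw, h.measure_card_survivors_eq_add_one, h.measure_card_rootSurvivors,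
      survivorLaw_node_succ]
    simp_rw [hl (h.childRel preimage_cons_zero_innerWords),
      hr (h.childRel preimage_cons_one_innerWords)]

end IndependentMarks

/-! ### The shape of the Galton-Watson tree -/

section Shape

variable {Ω : Type*} {ξ : List ℕ → Ω → ℕ}

/-- The event that the tree `treeOf (ξ · ω)` has the shape `t`. -/
def shapeEvent (ξ : List ℕ → Ω → ℕ) (t : BinaryTree Unit) : Set Ω :=
  {ω | treeOf (fun v => ξ v ω) = words t}

theorem shapeEvent_eq_iInter (t : BinaryTree Unit) :
    shapeEvent ξ t = ⋂ x ∈ words t, ξ x ⁻¹' {if x ∈ innerWords t then 2 else 0} := by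
  ext ω
  have hleaf : ∀ x ∈ leafWords t, x ∉ innerWords t := fun x hx hx' =>
    Finset.disjoint_left.1 (disjoint_innerWords_leafWords t) hx' hx
  rw [shapeEvent, Set.mem_ofPred_eq, treeOf_eq_words_iff]
  simp +contextual [words, or_imp, forall_and, hleaf]

theorem pairwise_disjoint_shapeEvent : Pairwise (Function.onFun Disjoint (shapeEvent ξ)) :=
  fun _ _ hne => Set.disjoint_left.2 fun _ h h' =>
    hne (words_injective (Finset.coe_injective (h.symm.trans h')))

theorem encard_leaves_treeOf {t : BinaryTree Unit} {ω : Ω} (hω : ω ∈ shapeEvent ξ t) :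
    (leaves (treeOf fun v => ξ v ω)).encard = (t.numNodes + 1 : ℕ) := by
  rw [show treeOf (fun v => ξ v ω) = words t from hω, encard_leaves_words]

theorem criticalLaw_succ (j : ℕ) : criticalLaw (j + 1) = catalan j * (2 ^ (2 * j + 1))⁻¹ := by
  have hcatalan : ((j : ℝ) + 1) * catalan j = (2 * j).choose j := by
    exact_mod_cast succ_mul_catalan_eq_centralBinom j
  rw [criticalLaw, show 2 * (j + 1) - 2 = 2 * j by lia, Nat.add_sub_cancel, ← hcatalan,
    pow_succ, pow_succ, pow_mul]
  push_cast
  field_simp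
  ring

theorem offspringLaw_zero : offspringLaw {0} = 2⁻¹ := by simp [offspringLaw]

theorem offspringLaw_two : offspringLaw {2} = 2⁻¹ := by simp [offspringLaw]

variable [MeasurableSpace Ω] {P : Measure Ω}

theorem measurableSet_shapeEvent (hξ : ∀ v, Measurable (ξ v)) (t : BinaryTree Unit) :
    MeasurableSet (shapeEvent ξ t) := by
  rw [shapeEvent_eq_iInter]
  exact Finset.measurableSet_biInter _ fun x _ => hξ x (measurableSet_singleton _)

namespace IsCriticalBinaryGW

theorem measure_shapeEvent (hξ : IsCriticalBinaryGW P ξ) (t : BinaryTree Unit) :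
    P (shapeEvent ξ t) = weight t := by
  have hfactor : ∀ x, P (ξ x ⁻¹' {if x ∈ innerWords t then 2 else 0}) = 2⁻¹ := fun x => by
    rw [← Measure.map_apply (hξ.measurable x) (measurableSet_singleton _), hξ.law]
    split_ifs
    exacts [offspringLaw_two, offspringLaw_zero]
  rw [shapeEvent_eq_iInter, hξ.indep.measure_inter_preimage_eq_mul _
    fun x _ => measurableSet_singleton _, Finset.prod_congr rfl fun x _ => hfactor x,
    Finset.prod_const, card_words, weight, ENNReal.inv_pow]

theorem ae_exists_mem_shapeEvent (hξ : IsCriticalBinaryGW P ξ) :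
    ∀ᵐ ω ∂P, ∃ t, ω ∈ shapeEvent ξ t := by
  have := hξ.indep.isProbabilityMeasure
  have hunion : P (⋃ t, shapeEvent ξ t) = 1 := by
    rw [measure_iUnion pairwise_disjoint_shapeEvent (measurableSet_shapeEvent hξ.measurable)]
    simp_rw [hξ.measure_shapeEvent, tsum_weight]
  have hmeas : MeasurableSet (⋃ t, shapeEvent ξ t) :=
    .iUnion (measurableSet_shapeEvent hξ.measurable)
  filter_upwards [(mem_ae_iff_prob_eq_one hmeas).2 hunion] with ω hω
  exact Set.mem_iUnion.1 hω

theorem measure_eq_tsum (hξ : IsCriticalBinaryGW P ξ) (A : Set Ω) :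
    P A = ∑' t, P (A ∩ shapeEvent ξ t) := by
  have hrestrict : P.restrict (⋃ t, shapeEvent ξ t) = P :=
    Measure.restrict_eq_self_of_ae_mem <|
      hξ.ae_exists_mem_shapeEvent.mono fun _ => Set.mem_iUnion.2
  conv_lhs => rw [← hrestrict, Measure.restrict_iUnion pairwise_disjoint_shapeEvent
    (measurableSet_shapeEvent hξ.measurable), Measure.sum_apply_of_countable]
  exact tsum_congr fun t => Measure.restrict_apply' (measurableSet_shapeEvent hξ.measurable t)

theorem measure_encard_leaves (hξ : IsCriticalBinaryGW P ξ) {k : ℕ} (hk : 1 ≤ k) :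
    P.real {ω | (leaves (treeOf fun v => ξ v ω)).encard = (k : ℕ∞)} = criticalLaw k := by
  obtain ⟨j, rfl⟩ := Nat.exists_eq_add_of_le' hk
  have hshape : ∀ t, P ({ω | (leaves (treeOf fun v => ξ v ω)).encard = ((j + 1 : ℕ) : ℕ∞)} ∩
      shapeEvent ξ t) = if t.numNodes = j then weight t else 0 := fun t => by
    have hinter : {ω | (leaves (treeOf fun v => ξ v ω)).encard = ((j + 1 : ℕ) : ℕ∞)} ∩
        shapeEvent ξ t = {ω ∈ shapeEvent ξ t | t.numNodes = j} := by
      ext ω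
      rw [Set.inter_comm]
      refine and_congr_right fun hω => ?_
      rw [Set.mem_ofPred_eq, encard_leaves_treeOf hω, Nat.cast_inj, Nat.add_left_inj]
    rw [hinter]
    split_ifs with ht <;> simp [ht, hξ.measure_shapeEvent]
  rw [measureReal_def, hξ.measure_eq_tsum, tsum_congr hshape, tsum_weight_numNodes_eq,
    criticalLaw_succ]
  simp

end IsCriticalBinaryGW

end Shape

/-! ### Marks given the tree and the edge lengths -/

theorem integral_exp_neg_mul_expMeasure {r c : ℝ} (hr : 0 < r) (hrc : 0 < r + c) :
    ∫ s, Real.exp (-(c * s)) ∂expMeasure r = r / (r + c) := by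
  have hdensity : ∀ s, (gammaPDF 1 r s).toReal • Real.exp (-(c * s)) =
      (Set.Ici 0).indicator (fun s => r * Real.exp (-(r + c) * s)) s := fun s => by
    rw [show gammaPDF 1 r s = exponentialPDF r s from rfl]
    by_cases hs : 0 ≤ s
    · rw [Set.indicator_of_mem (Set.mem_Ici.2 hs), exponentialPDF_of_nonneg hs,
        ENNReal.toReal_ofReal (by positivity), smul_eq_mul, mul_assoc, ← Real.exp_add]
      ring_nf
    · rw [Set.indicator_of_notMem (Set.mem_Ici.not.2 hs), exponentialPDF_of_neg (not_le.1 hs),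
        ENNReal.toReal_zero, zero_smul]
  have hmeas : Measurable (gammaPDF 1 r) := (measurable_gammaPDFReal 1 r).ennreal_ofReal
  rw [expMeasure, gammaMeasure, integral_withDensity_eq_integral_toReal_smul hmeas
    (.of_forall fun _ => ENNReal.ofReal_lt_top),
    integral_congr_ae (.of_forall hdensity), integral_indicator measurableSet_Ici,
    integral_Ici_eq_integral_Ioi, integral_const_mul, integral_exp_mul_Ioi (by linarith),
    mul_zero, Real.exp_zero, neg_div_neg_eq, mul_one_div]

theorem ae_expMeasure_pos {r : ℝ} (hr : 0 < r) : ∀ᵐ s ∂expMeasure r, 0 < s := by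
  have := isProbabilityMeasure_expMeasure hr
  have hcdf : (expMeasure r).real (Set.Iic 0) = 0 := by
    simpa [cdf_eq_real] using cdf_expMeasure_eq hr 0
  simp only [ae_iff, not_lt]
  exact (measureReal_eq_zero_iff).1 hcdf

section CondProb

variable {Ω : Type*} {m mΩ : MeasurableSpace Ω} {P : Measure Ω} [IsFiniteMeasure P] {A B : Set Ω}

theorem setIntegral_condProb (hm : m ≤ mΩ) (hA : MeasurableSet A) (hB : MeasurableSet[m] B) :
    ∫ ω in B, (P⟦A | m⟧) ω ∂P = P.real (B ∩ A) := by
  rw [setIntegral_condExp hm ((integrable_const 1).indicator hA) hB,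
    setIntegral_indicator hA, setIntegral_const, smul_eq_mul, mul_one]

theorem setLIntegral_condProb (hm : m ≤ mΩ) (hA : MeasurableSet A) (hB : MeasurableSet[m] B) :
    ∫⁻ ω in B, ENNReal.ofReal ((P⟦A | m⟧) ω) ∂P = P (B ∩ A) := by
  have hnonneg : 0 ≤ᵐ[P] P⟦A | m⟧ :=
    condExp_nonneg (.of_forall fun _ => Set.indicator_nonneg (fun _ _ => zero_le_one) _)
  rw [← ofReal_integral_eq_lintegral_ofReal integrable_condExp.integrableOn
    (ae_restrict_of_ae hnonneg), setIntegral_condProb hm hA hB, ofReal_measureReal]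

theorem ae_ne_top_of_tsum_condProb_eq_one (hm : m ≤ mΩ) {X : Ω → ℕ∞} (hX : Measurable X)
    (hB : MeasurableSet[m] B) (h : ∀ᵐ ω ∂P, ω ∈ B →
      ∑' k : ℕ, ENNReal.ofReal ((P⟦{ω | X ω = k} | m⟧) ω) = 1) :
    ∀ᵐ ω ∂P, ω ∈ B → X ω ≠ ⊤ := by
  have hlevel : ∀ k : ℕ, MeasurableSet ({ω | X ω = k}) := fun k =>
    hX (measurableSet_singleton _)
  have hunion : {ω | X ω ≠ ⊤} = ⋃ k : ℕ, {ω | X ω = k} := by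
    ext ω
    simp [ENat.ne_top_iff_exists, eq_comm]
  have hmeas : MeasurableSet {ω | X ω ≠ ⊤} := hunion ▸ .iUnion hlevel
  have hdisjoint : Pairwise (Function.onFun Disjoint fun k : ℕ => {ω | X ω = k}) :=
    fun i j hij => Set.disjoint_left.2 fun ω (hi : X ω = i) (hj : X ω = j) =>
      hij (Nat.cast_injective (hi.symm.trans hj))
  refine (ae_restrict_iff' (hm _ hB)).1 ((ae_iff_measure_eq hmeas.nullMeasurableSet).2 ?_)
  calc P.restrict B {ω | X ω ≠ ⊤}
      = ∑' k : ℕ, ∫⁻ ω in B, ENNReal.ofReal ((P⟦{ω | X ω = k} | m⟧) ω) ∂P := by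
        rw [hunion, measure_iUnion hdisjoint hlevel]
        exact tsum_congr fun k => by
          rw [setLIntegral_condProb hm (hlevel k) hB, Measure.restrict_apply (hlevel k),
            Set.inter_comm]
    _ = ∫⁻ ω in B, ∑' k : ℕ, ENNReal.ofReal ((P⟦{ω | X ω = k} | m⟧) ω) ∂P :=
        (lintegral_tsum fun k =>
          integrable_condExp.aestronglyMeasurable.aemeasurable.restrict.ennreal_ofReal).symm
    _ = ∫⁻ _ in B, 1 ∂P := setLIntegral_congr_fun_ae (hm _ hB) h
    _ = P.restrict B Set.univ := by rw [lintegral_one]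

end CondProb

section Edge

/-- The points of the edge with upper end `v`. -/
def edge (v : List ℕ) : Set (List ℕ × ℝ) := {p | p.1 = v}

theorem measurablePoints_edge (v : List ℕ) : MeasurablePoints (edge v) := fun w =>
  .const (w = v)

theorem encard_inter_edge_eq_zero_iff {π : List ℕ → Set (List ℕ × ℝ)} {x v : List ℕ} :
    (π x ∩ edge v).encard = 0 ↔ ¬ SendsMark π x v := by
  simp only [SendsMark, Set.encard_eq_zero, Set.eq_empty_iff_forall_notMem, edge, Prod.forall,
    Set.mem_inter_iff, Set.mem_ofPred_eq, not_and, not_exists]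
  exact ⟨fun h s hs => h v s hs rfl, fun h w s hs hw => h s (hw ▸ hs)⟩

theorem branchLength_edge (κ : List ℕ → ℝ) {x v : List ℕ} (h : v <+: x) :
    branchLength κ x (edge v) = ENNReal.ofReal (κ v) := by
  have htake : ∀ i ∈ Finset.range (x.length + 1), x.take i = v → i = v.length := by
    rintro i hi rfl
    rw [List.length_take_of_le (Nat.lt_succ_iff.1 (Finset.mem_range.1 hi))]
  have hedge : {s | (v, s) ∈ edge v ∩ branch κ x} = Set.Ioc 0 (κ v) := by
    ext s
    simp [edge, branch, h]
  rw [branchLength, Finset.sum_eq_single_of_mem v.length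
    (Finset.mem_range.2 (Nat.lt_succ_of_le h.length_le)), ← List.prefix_iff_eq_take.1 h, hedge,
    Real.volume_Ioc, sub_zero]
  exact fun i hi hne => measure_mono_null (fun s hs => hne (htake i hi hs.1)) measure_empty

end Edge

section SigmaTree

variable {Ω : Type*} {G : Ω → Set (List ℕ)} {κ : List ℕ → Ω → ℝ}

theorem measurableSet_sigmaTree_mem (v : List ℕ) :
    MeasurableSet[sigmaTree G κ] {ω | v ∈ G ω} := by
  refine (le_sup_left.trans' (le_iSup _ v) : _ ≤ sigmaTree G κ) _ ⟨{True}, trivial, ?_⟩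
  ext ω
  simp

theorem measurableSet_sigmaTree_eq (T : Set (List ℕ)) :
    MeasurableSet[sigmaTree G κ] {ω | G ω = T} := by
  simp_rw [Set.ext_iff, Set.ofPred_forall]
  exact .iInter fun u => (measurableSet_sigmaTree_mem u).iff (.const _)

theorem measurableSet_sigmaTree_mem_nodes (x : List ℕ) :
    MeasurableSet[sigmaTree G κ] {ω | x ∈ nodes (G ω)} := by
  have hnodes : {ω | x ∈ nodes (G ω)} = {ω | x ∈ G ω} ∩ ⋃ i, {ω | x ++ [i] ∈ G ω} := by
    ext ω
    simp +contextual [nodes, leaves]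
  rw [hnodes]
  exact (measurableSet_sigmaTree_mem x).inter (.iUnion fun i => measurableSet_sigmaTree_mem _)

variable [MeasurableSpace Ω] {ξ : List ℕ → Ω → ℕ}

theorem measurableSet_mem_treeOf (hξ : ∀ v, Measurable (ξ v)) (u : List ℕ) :
    MeasurableSet {ω | u ∈ treeOf fun v => ξ v ω} := by
  have hset : {ω | u ∈ treeOf fun v => ξ v ω} =
      ⋂ v, ⋂ i, ⋂ _ : v ++ [i] <+: u, {ω | i < ξ v ω} := by
    ext ω
    simp [treeOf]
  rw [hset]
  exact .iInter fun v => .iInter fun i => .iInter fun _ => measurableSet_lt measurable_const (hξ v)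

theorem sigmaTree_treeOf_le (hξ : ∀ v, Measurable (ξ v)) (hκ : ∀ v, Measurable (κ v)) :
    sigmaTree (fun ω => treeOf fun v => ξ v ω) κ ≤ ‹MeasurableSpace Ω› :=
  sup_le (iSup_le fun v => (measurableSet_setOfPred.1 (measurableSet_mem_treeOf hξ v)).comap_le)
    (iSup_le fun v => (hκ v).comap_le)

end SigmaTree

section Marks

variable {Ω : Type*} [MeasurableSpace Ω] {P : Measure Ω} {n : ℕ} {ξ : List ℕ → Ω → ℕ}
  {G : Ω → Set (List ℕ)} {κ : List ℕ → Ω → ℝ} {π : List ℕ → Ω → Set (List ℕ × ℝ)}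

theorem IsExpLengths.ae_pos (hκ : IsExpLengths P ξ κ) : ∀ᵐ ω ∂P, ∀ v, 0 < κ v ω :=
  ae_all_iff.2 fun v => ae_of_ae_map (hκ.measurable v).aemeasurable <| by
    rw [hκ.law]
    exact ae_expMeasure_pos two_pos

theorem IsExpLengths.integral_prod_exp (hκ : IsExpLengths P ξ κ) (n : ℕ)
    (V : Finset (List ℕ)) (j : List ℕ → ℕ) :
    ∫ ω, ∏ v ∈ V, Real.exp (-((j v : ℝ) / n * κ v ω)) ∂P =
      ∏ v ∈ V, (keepProb n (j v) : ℝ) := by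
  have hfactor : ∀ v, ∫ ω, Real.exp (-((j v : ℝ) / n * κ v ω)) ∂P = keepProb n (j v) := fun v => by
    rw [← integral_map (f := fun s => Real.exp (-((j v : ℝ) / n * s)))
      (hκ.measurable v).aemeasurable (by fun_prop : Continuous _).aestronglyMeasurable, hκ.law,
      integral_exp_neg_mul_expMeasure two_pos (by positivity), keepProb]
  have hindep := hκ.indep.precomp (Subtype.val_injective (p := (· ∈ V)))
  simp_rw [← Finset.prod_coe_sort V, ← hfactor]
  exact hindep.integral_fun_prod_comp (f := fun (v : V) s => Real.exp (-((j v : ℝ) / n * s)))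
    (fun v => (hκ.measurable v).aemeasurable)
    fun v => (by fun_prop : Continuous _).aestronglyMeasurable

namespace IsPoissonMarks

theorem ae_finite [IsFiniteMeasure P] (hm : sigmaTree G κ ≤ ‹MeasurableSpace Ω›)
    (hπ : IsPoissonMarks P n G κ π) : ∀ᵐ ω ∂P, ∀ x ∈ nodes (G ω), (π x ω).Finite := by
  refine ae_all_iff.2 fun x => ?_
  have huniv : MeasurablePoints Set.univ := fun _ => .univ
  have hlaw : ∀ᵐ ω ∂P, ∀ k : ℕ, x ∈ nodes (G ω) →
      (P⟦{ω | (π x ω ∩ Set.univ).encard = (k : ℕ∞)} | sigmaTree G κ⟧) ω =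
        (poissonMeasure ((branchLength (fun v => κ v ω) x Set.univ).toNNReal / n)).real {k} :=
    ae_all_iff.2 fun k => by
      filter_upwards [hπ.cond_law 1 (fun _ => x) (fun _ => Set.univ) (fun _ => k)
        (fun _ => huniv) fun i j hij => absurd (Subsingleton.elim i j) hij] with ω hω hx
      simpa using hω fun _ => hx
  have hfinite := ae_ne_top_of_tsum_condProb_eq_one (P := P) hm (hπ.measurable x _ huniv)
    (measurableSet_sigmaTree_mem_nodes x) <| by
      filter_upwards [hlaw] with ω hω hx
      rw [tsum_congr fun k => by rw [hω k hx, ofReal_measureReal]]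
      exact (poissonMeasure _).toPMF.tsum_coe
  filter_upwards [hfinite] with ω hω hx
  simpa using hω hx

theorem measurableSet_noMarks (hπ : IsPoissonMarks P n G κ π) (v : List ℕ)
    (S : Finset (List ℕ)) :
    MeasurableSet (noMarks (fun ω => SendsMark fun x => π x ω) v S) := by
  simp_rw [noMarks, ← encard_inter_edge_eq_zero_iff, Set.ofPred_forall]
  exact .iInter fun x => .iInter fun _ =>
    hπ.measurable x _ (measurablePoints_edge v) (measurableSet_singleton _)

theorem condProb_not_sendsMark (hκ : ∀ᵐ ω ∂P, ∀ v, 0 ≤ κ v ω) (hπ : IsPoissonMarks P n G κ π)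
    (E : Finset (Σ _ : List ℕ, List ℕ)) (hE : ∀ p ∈ E, p.1 <+: p.2) :
    ∀ᵐ ω ∂P, (∀ p ∈ E, p.2 ∈ nodes (G ω)) →
      (P⟦{ω' | ∀ p ∈ E, ¬ SendsMark (fun x => π x ω') p.2 p.1} | sigmaTree G κ⟧) ω =
        ∏ p ∈ E, Real.exp (-(κ p.1 ω / n)) := by
  let e := E.equivFin.symm
  have hset : {ω' | ∀ p ∈ E, ¬ SendsMark (fun x => π x ω') p.2 p.1} =
      {ω' | ∀ j, (π (e j).1.2 ω' ∩ edge (e j).1.1).encard = (0 : ℕ)} := by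
    ext ω
    simp only [Set.mem_ofPred_eq, Nat.cast_zero,
      encard_inter_edge_eq_zero_iff (π := fun x => π x ω),
      e.forall_congr_left (p := fun j => ¬ SendsMark (fun x => π x ω) (e j).1.2 (e j).1.1),
      e.apply_symm_apply, Subtype.forall]
  have hvoid : ∀ ω, (∀ v, 0 ≤ κ v ω) → ∀ p ∈ E, (poissonMeasure ((branchLength (fun v => κ v ω)
      p.2 (edge p.1)).toNNReal / n)).real {0} = Real.exp (-(κ p.1 ω / n)) := fun ω hω p hp => by
    rw [branchLength_edge _ (hE p hp), poissonMeasure_real_singleton]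
    simp [ENNReal.ofReal, hω p.1]
  have hlaw := hπ.cond_law _ (fun j => (e j).1.2) (fun j => edge (e j).1.1) (fun _ => 0)
    (fun j => measurablePoints_edge _) fun i j hij hx => Set.disjoint_left.2
      fun p (hi : p.1 = (e i).1.1) (hj : p.1 = (e j).1.1) =>
        hij (e.injective (Subtype.ext (Sigma.ext (hi.symm.trans hj) (heq_of_eq hx))))
  filter_upwards [hlaw, hκ] with ω hω hnonneg hnodes
  rw [hset, hω fun j => hnodes _ (e j).2, Finset.prod_congr rfl fun j _ =>
    hvoid ω hnonneg _ (e j).2, e.prod_comp fun p : E => Real.exp (-(κ p.1.1 ω / n)),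
    Finset.prod_coe_sort E fun p => Real.exp (-(κ p.1 ω / n))]

theorem condProb_noMarks (hκ : ∀ᵐ ω ∂P, ∀ v, 0 ≤ κ v ω) (hπ : IsPoissonMarks P n G κ π)
    (V : Finset (List ℕ)) {S : List ℕ → Finset (List ℕ)} (hS : ∀ v ∈ V, ∀ x ∈ S v, v <+: x) :
    ∀ᵐ ω ∂P, (∀ v ∈ V, ∀ x ∈ S v, x ∈ nodes (G ω)) →
      (P⟦⋂ v ∈ V, noMarks (fun ω' => SendsMark fun x => π x ω') v (S v) | sigmaTree G κ⟧) ω =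
        ∏ v ∈ V, Real.exp (-(((S v).card : ℝ) / n * κ v ω)) := by
  have hsigma : ∀ {q : (Σ _ : List ℕ, List ℕ) → Prop},
      (∀ p ∈ V.sigma S, q p) ↔ ∀ v ∈ V, ∀ x ∈ S v, q ⟨v, x⟩ :=
    ⟨fun h v hv x hx => h _ (Finset.mem_sigma.2 ⟨hv, hx⟩), fun h p hp =>
      h _ (Finset.mem_sigma.1 hp).1 _ (Finset.mem_sigma.1 hp).2⟩
  have hset : ⋂ v ∈ V, noMarks (fun ω' => SendsMark fun x => π x ω') v (S v) =
      {ω' | ∀ p ∈ V.sigma S, ¬ SendsMark (fun x => π x ω') p.2 p.1} := by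
    ext ω
    simp only [noMarks, Set.mem_iInter, Set.mem_ofPred_eq, hsigma]
  filter_upwards [hπ.condProb_not_sendsMark hκ (V.sigma S) (hsigma.2 hS)] with ω hω hnodes
  rw [hset, hω (hsigma.2 hnodes), Finset.prod_sigma]
  refine Finset.prod_congr rfl fun v _ => ?_
  simp only [Finset.prod_const, ← Real.exp_nat_mul]
  ring_nf

end IsPoissonMarks

end Marks

section Pruned

variable {Ω : Type*} [MeasurableSpace Ω] {P : Measure Ω} {n : ℕ}
  {ξ : List ℕ → Ω → ℕ} {κ : List ℕ → Ω → ℝ} {π : List ℕ → Ω → Set (List ℕ × ℝ)}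

theorem measureReal_shapeEvent_inter_noMarks (hξ : ∀ v, Measurable (ξ v))
    (hκ : IsExpLengths P ξ κ) (hπ : IsPoissonMarks P n (fun ω => treeOf fun v => ξ v ω) κ π)
    (t : BinaryTree Unit) (V : Finset (List ℕ)) {S : List ℕ → Finset (List ℕ)}
    (hS : ∀ v ∈ V, S v ⊆ nodesAbove t v) :
    P.real (shapeEvent ξ t ∩ ⋂ v ∈ V, noMarks (fun ω => SendsMark fun x => π x ω) v (S v)) =
      P.real (shapeEvent ξ t) * ∏ v ∈ V, (keepProb n (S v).card : ℝ) := by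
  have := hκ.indep.isProbabilityMeasure
  have habove : ∀ v ∈ V, ∀ x ∈ S v, x ∈ innerWords t ∧ v <+: x := fun v hv x hx =>
    Finset.mem_filter.1 (hS v hv hx)
  have hm := sigmaTree_treeOf_le hξ hκ.measurable
  have hnoMarks : MeasurableSet
      (⋂ v ∈ V, noMarks (fun ω => SendsMark fun x => π x ω) v (S v)) :=
    .biInter V.countable_toSet fun v _ => hπ.measurableSet_noMarks v (S v)
  have hshape : MeasurableSet[sigmaTree (fun ω => treeOf fun v => ξ v ω) κ] (shapeEvent ξ t) :=
    measurableSet_sigmaTree_eq _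
  have hcond : ∀ᵐ ω ∂P, ω ∈ shapeEvent ξ t → (P⟦⋂ v ∈ V, noMarks (fun ω' => SendsMark
      fun x => π x ω') v (S v) | sigmaTree (fun ω => treeOf fun v => ξ v ω) κ⟧) ω =
        ∏ v ∈ V, Real.exp (-(((S v).card : ℝ) / n * κ v ω)) := by
    have hnonneg : ∀ᵐ ω ∂P, ∀ v, 0 ≤ κ v ω := hκ.ae_pos.mono fun _ h v => (h v).le
    filter_upwards [hπ.condProb_noMarks hnonneg V fun v hv x hx => (habove v hv x hx).2]
      with ω hω hshape
    refine hω fun v hv x hx => ?_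
    rw [show treeOf (fun v => ξ v ω) = words t from hshape, nodes_words]
    exact (habove v hv x hx).1
  rw [← setIntegral_condProb hm hnoMarks hshape, setIntegral_congr_ae (hm _ hshape) hcond,
    ← hκ.integral_prod_exp]
  exact Indep.setIntegral_eq_mul (X := fun ω v => κ v ω) (f := fun k : List ℕ → ℝ => ∏ v ∈ V,
    Real.exp (-(((S v).card : ℝ) / n * k v))) (measurable_pi_lambda _ hξ).comap_le
    hκ.indep_tree (measurable_pi_lambda _ hκ.measurable).aemeasurable
    ⟨_, measurableSet_shapeEvent measurable_pi_apply t, rfl⟩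
    (by fun_prop : Measurable _).aestronglyMeasurable

theorem hasIndepEdgeMarks_cond_shapeEvent (hξ : IsCriticalBinaryGW P ξ)
    (hκ : IsExpLengths P ξ κ) (hπ : IsPoissonMarks P n (fun ω => treeOf fun v => ξ v ω) κ π)
    (t : BinaryTree Unit) :
    HasIndepEdgeMarks (P[|shapeEvent ξ t]) (keepProb n) (fun ω => SendsMark fun x => π x ω) t where
  measurableSet v S _ := hπ.measurableSet_noMarks v S
  measure_iInter V S hS := by
    have := hκ.indep.isProbabilityMeasure
    have hne : P (shapeEvent ξ t) ≠ 0 := hξ.measure_shapeEvent t ▸ weight_ne_zero t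
    have hne' : P.real (shapeEvent ξ t) ≠ 0 := (measureReal_ne_zero_iff).2 hne
    rw [← ENNReal.toReal_eq_toReal_iff' (measure_ne_top _ _)
      (ENNReal.prod_ne_top fun _ _ => ENNReal.coe_ne_top),
      cond_apply (measurableSet_shapeEvent hξ.measurable t), ENNReal.toReal_mul,
      ENNReal.toReal_inv, ← measureReal_def, ← measureReal_def,
      measureReal_shapeEvent_inter_noMarks hξ.measurable hκ hπ t V hS,
      inv_mul_cancel_left₀ hne', ENNReal.toReal_prod]
    rfl

theorem measure_encard_leaves_prune_inter_shapeEvent (hξ : IsCriticalBinaryGW P ξ)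
    (hκ : IsExpLengths P ξ κ) (hπ : IsPoissonMarks P n (fun ω => treeOf fun v => ξ v ω) κ π)
    (t : BinaryTree Unit) (j : ℕ) :
    P ({ω | (leaves (prune (fun v => κ v ω) (fun x => π x ω) (treeOf fun v => ξ v ω))).encard =
      ((j + 1 : ℕ) : ℕ∞)} ∩ shapeEvent ξ t) = weight t * survivorLaw (keepProb n) t j := by
  have := hκ.indep.isProbabilityMeasure
  have hsurvivors := (hasIndepEdgeMarks_cond_shapeEvent hξ hκ hπ t).measure_card_survivors j
  rw [← hsurvivors, mul_comm, ← hξ.measure_shapeEvent,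
    cond_mul_eq_inter (measurableSet_shapeEvent hξ.measurable t), Set.inter_comm]
  refine measure_congr ?_
  filter_upwards [hπ.ae_finite (sigmaTree_treeOf_le hξ.measurable hκ.measurable), hκ.ae_pos]
    with ω hfin hpos
  refine propext (and_congr_right fun hω => ?_)
  have htree : treeOf (fun v => ξ v ω) = words t := hω
  have hnodes : ∀ x ∈ innerWords t, x ∈ nodes (treeOf fun v => ξ v ω) := fun x hx => by
    rwa [htree, nodes_words]
  rw [Set.mem_ofPred_eq, htree, encard_leaves_prune hpos
    (fun x hx => hπ.subset_branch x ω (hnodes x hx)) fun x hx => hfin x (hnodes x hx)]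
  norm_cast
  exact Nat.add_right_cancel_iff

theorem measure_encard_leaves_prune (hξ : IsCriticalBinaryGW P ξ) (hκ : IsExpLengths P ξ κ)
    (hπ : IsPoissonMarks P n (fun ω => treeOf fun v => ξ v ω) κ π) {k : ℕ} (hk : 1 ≤ k) :
    P.real {ω | (leaves (prune (fun v => κ v ω) (fun x => π x ω)
      (treeOf fun v => ξ v ω))).encard = (k : ℕ∞)} = leafLaw (keepProb n) k := by
  obtain ⟨j, rfl⟩ := Nat.exists_eq_add_of_le' hk
  rw [measureReal_def, hξ.measure_eq_tsum, leafLaw, prunedLaw_apply]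
  simp_rw [measure_encard_leaves_prune_inter_shapeEvent hξ hκ hπ]

end Pruned

end ForestFire

theorem mainTheorem4 {Ω : Type*} [MeasurableSpace Ω] (P : Measure Ω) [IsProbabilityMeasure P]
    (n : ℕ) (hn : 1 ≤ n) (ξ : List ℕ → Ω → ℕ) (G : Ω → Set (List ℕ))
    (hξ : ForestFire.IsCriticalBinaryGW P ξ)
    (hG : ∀ ω, G ω = ForestFire.treeOf (fun v => ξ v ω)) :
    (∀ᵐ ω ∂P, (G ω).Finite) ∧
    (∀ k : ℕ, 1 ≤ k →
      P.real {ω | (ForestFire.leaves (G ω)).encard = (k : ℕ∞)} = ForestFire.criticalLaw k) ∧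
    ∃ c : ℕ → ℝ, ForestFire.IsEquilibrium n c ∧
      (∀ c' : ℕ → ℝ, ForestFire.IsEquilibrium n c' → c' = c) ∧
      ∀ (κ : List ℕ → Ω → ℝ) (π : List ℕ → Ω → Set (List ℕ × ℝ)),
        ForestFire.IsExpLengths P ξ κ → ForestFire.IsPoissonMarks P n G κ π →
        (∀ᵐ ω ∂P, ∀ x ∈ ForestFire.nodes (G ω), (π x ω).Finite) ∧
        ∀ k : ℕ, 1 ≤ k →
          P.real {ω | (ForestFire.leaves
              (ForestFire.prune (fun v => κ v ω) (fun x => π x ω) (G ω))).encard = (k : ℕ∞)}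
            = c k / ForestFire.moment 0 c := by
  obtain rfl : G = fun ω => ForestFire.treeOf fun v => ξ v ω := funext hG
  have hlaw := ForestFire.isTypicalMassLaw_leafLaw n
  have hc := hlaw.isEquilibrium_div hn
  refine ⟨?_, fun k hk => hξ.measure_encard_leaves hk, _, hc, fun c' hc' => hc'.unique hc,
    fun κ π hκ hπ => ⟨hπ.ae_finite (ForestFire.sigmaTree_treeOf_le hξ.measurable hκ.measurable),
      fun k hk => ?_⟩⟩
  · filter_upwards [hξ.ae_exists_mem_shapeEvent] with ω ⟨t, ht⟩
    rw [show ForestFire.treeOf (fun v => ξ v ω) = ForestFire.words t from ht]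
    exact Finset.finite_toSet _
  · rw [hc.div_moment_zero_eq_leafLaw]
    exact ForestFire.measure_encard_leaves_prune hξ hκ hπ hk
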